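/- Let $K$ be a field of characteristic $0$, and let $E$ be a differential field extension of $K(x,y)$, i.e. a field containing $K(x,y)$ with two commuting derivations $D_x,D_y$ that vanish on $K$ and satisfy $D_xx=D_yy=1$, $D_xy=D_yx=0$. An element $Q\neq0$ of $E$ is called hyperexponential if $(D_xQ)/Q$ and $(D_yQ)/Q$ lie in $K(x,y)$. Let $a,b,c_0,\dots,c_L\in K[x,y]$ with $b,c_0,\dots,c_L$ nonzero, let $e_1,\dots,e_L\in K\setminus\{0\}$, and assume that $\max\{\deg_xa,\deg_xb\}+\sum_{\ell}\deg_xc_\ell$ and $\max\{\deg_ya,\deg_yb\}+\sum_{\ell}\deg_yc_\ell$ are nonzero. Let $$h=c_0\exp\Bigl(\frac ab\Bigr)\prod_{\ell=1}^L c_\ell^{e_\ell}\in E,$$ where $\exp(a/b)$ and $c_\ell^{e_\ell}$ denote nonzero elements of $E$ on which $D_x,D_y$ act as the notation suggests. A creative telescoping relation for $h$ of order $r$ and degree $d$ is an identity $p_0h+p_1D_xh+\cdots+p_rD_x^rh=D_yQ$ with $p_0,\dots,p_r\in K[x]$, $p_r\neq0$, $\max_i\deg_xp_i=d$, where $Q\in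 E$ is zero or hyperexponential. Write $b^*$ for the square free part of $b$, $\operatorname{lc}_x$ for the leading coefficient with respect to $x$ (an element of $K[y]$), $[\Phi]=1$ if $\Phi$ holds and $0$ otherwise, $z^+=\max\{0,z\}$, and $\deg 0=-\infty$. Put $$\alpha=\deg_xb^*+\deg_xb+\sum_\ell\deg_xc_\ell,\qquad \beta=\deg_xa-\deg_xb-1,$$ $$\gamma=\deg_yb^*+\max\{\deg_ya,\deg_yb\}+\sum_\ell\deg_yc_\ell,\qquad \omega=\deg_xc_0+\sum_\ell e_\ell\deg_xc_\ell\in K,$$ $$\phi_1=\Bigl[\tfrac{\operatorname{lc}_xa}{\operatorname{lc}_xb}\in K\Bigr],\qquad \phi_2=\Bigl[\tfrac{\operatorname{lc}_xa}{\operatorname{lc}_xb}\in K\wedge\beta=0\Bigr],$$ $$\phi_3=\Bigl[\tfrac ab\in K(x)\ \wedge\ \forall\ell\colon(\deg_yc_\ell=0\vee e_\ell\in\mathbb Z)\ \wedge\ \deg_yc_0+\sum_\ell e_\ell\deg_yc_\ell\ge-1\Bigr],\qquad \psi=\gamma+\phi_3-2.$$ Then, for $r,d\in\mathbb N$, a creative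 telescoping relation for $h$ of order $r$ and degree $d$ exists whenever $$r\ge\psi+1\quad\text{and}\quad d>\frac{\vartheta r+\varphi}{r-\psi},$$ where $\vartheta,\varphi$ are as follows. 1. If $\deg_xa>\deg_xb$, then $\vartheta=(\alpha+\beta)(2\gamma-1+\phi_3)+\gamma-1$ and $$\varphi=\deg_xc_0+(\alpha+\beta+1)\deg_yc_0+(\gamma-2+\phi_3)(\deg_xc_0-\alpha-\beta-\phi_2)-(1-\phi_2)(\gamma-2+\phi_3)^+\bigl(\phi_1+\tfrac12\beta(\gamma-1+\phi_3)\bigr).$$ 2. If $\deg_xa\le\deg_xb$, then $\vartheta=\alpha(2\gamma-1+\phi_3)-1$ and $$\varphi=\deg_xc_0+\alpha\deg_yc_0+(\gamma-2+\phi_3)(\deg_xc_0+1-\alpha)-\tfrac12(\gamma-2+\phi_3)^+(\gamma+1+\phi_3).$$ If furthermore $\omega\in\mathbb N$ and $\gamma-1+\phi_3>\omega$, then, with $\delta=\omega+1$, $\varphi$ can be replaced by $$\varphi'=\varphi-\delta(\gamma-2+\phi_3-\omega)+1.$$ -/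

import Mathlib

open Polynomial
open scoped Polynomial.Bivariate

noncomputable section

namespace CreativeTelescoping

/-! Bivariate polynomials over `K` are `K[X][Y]`: the inner variable is `x`, the outer one is `y`. -/

/-- The field `K(x,y)` of bivariate rational functions. -/
abbrev RatXY (K : Type*) [Field K] := FractionRing K[X][Y]

section Degrees

variable {K : Type*} [Field K]

/-- Degree in `x` (with value `0` at the zero polynomial; below, degrees of a possibly vanishing
polynomial occur only in comparisons `deg a > deg b`, `deg a ≤ deg b`, in `max (deg a) (deg b)`
with `b ≠ 0`, and where `deg_x a > deg_x b`, so that `0` and `-∞` give the same result). -/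
def degX (p : K[X][Y]) : ℕ := (Bivariate.swap p).natDegree

/-- Degree in `y`. -/
def degY (p : K[X][Y]) : ℕ := p.natDegree

/-- Leading coefficient with respect to `x`, a polynomial in the variable `y`. -/
def lcX (p : K[X][Y]) : K[X] := (Bivariate.swap p).leadingCoeff

/-- Square free part of a nonzero polynomial: the product of its distinct (normalized)
irreducible factors in `K[x,y]` (the choice of normalization changes it by a constant only). -/
def sqfreePart (p : K[X][Y]) : K[X][Y] :=
  letI : StrongNormalizationMonoid K[X][Y] := UniqueFactorizationMonoid.strongNormalizationMonoid
  UniqueFactorizationMonoid.radical p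

end Degrees

/-- The embedding of `K[x,y]` into a field containing `K(x,y)`. -/
def emb {K : Type*} [Field K] (E : Type*) [Field E] [Algebra (RatXY K) E] (p : K[X][Y]) : E :=
  algebraMap (RatXY K) E (algebraMap K[X][Y] (RatXY K) p)

/-- The structure of a differential field extension of `K(x,y)` on a field `E` containing `K(x,y)`:
two commuting derivations of `E` which extend `D_x` and `D_y`, that is, which vanish on `K` and
have the prescribed values at `x` and `y`. -/
structure DiffExt (K E : Type*) [Field K] [Field E] [Algebra (RatXY K) E] where
  Dx : Derivation ℤ E E
  Dy : Derivation ℤ E E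
  Dx_const : ∀ k : K, Dx (emb E (C (C k))) = 0
  Dy_const : ∀ k : K, Dy (emb E (C (C k))) = 0
  Dx_x : Dx (emb E (C X : K[X][Y])) = 1
  Dx_y : Dx (emb E (X : K[X][Y])) = 0
  Dy_x : Dy (emb E (C X : K[X][Y])) = 0
  Dy_y : Dy (emb E (X : K[X][Y])) = 1
  comm : ∀ f : E, Dx (Dy f) = Dy (Dx f)

section Extension

variable {K E : Type*} [Field K] [Field E] [Algebra (RatXY K) E]

/-- `f` is hyperexponential over `K(x,y)`: `f ≠ 0`, and `(D_x f)/f` and `(D_y f)/f` are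
in `K(x,y)`. -/
def IsHyperexponential (D : DiffExt K E) (f : E) : Prop :=
  f ≠ 0 ∧
    D.Dx f / f ∈ Set.range (algebraMap (RatXY K) E) ∧
    D.Dy f / f ∈ Set.range (algebraMap (RatXY K) E)

/-- `g` is an element `exp(u)` of `E`. -/
def IsExp (D : DiffExt K E) (u g : E) : Prop :=
  g ≠ 0 ∧ D.Dx g = D.Dx u * g ∧ D.Dy g = D.Dy u * g

/-- `g` is an element `u ^ s` of `E`, where `u ≠ 0` and `s` is a constant. -/
def IsPow (D : DiffExt K E) (u s g : E) : Prop :=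
  g ≠ 0 ∧ D.Dx g = s * (D.Dx u / u) * g ∧ D.Dy g = s * (D.Dy u / u) * g

/-- There is a creative telescoping relation `p₀ h + p₁ D_x h + ⋯ + p_r D_x^r h = D_y Q` of order
exactly `r` (that is, `p_r ≠ 0`) and degree exactly `d = max deg_x p_i`, with polynomials
`p_i ∈ K[x]` and a certificate `Q` which is zero or hyperexponential. -/
def HasRelation (D : DiffExt K E) (h : E) (r d : ℕ) : Prop :=
  ∃ p : Fin (r + 1) → K[X],
    p (Fin.last r) ≠ 0 ∧
    (Finset.univ.sup fun i => (p i).natDegree) = d ∧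
    ∃ Q : E, (Q = 0 ∨ IsHyperexponential D Q) ∧
      ∑ i : Fin (r + 1), emb E (C (p i)) * (D.Dx)^[(i : ℕ)] h = D.Dy Q

end Extension

/-- The data `a, b, c₀, …, c_L, e₁, …, e_L` of a term `c₀ exp(a/b) ∏ c_ℓ ^ e_ℓ`. -/
structure TermData (K : Type*) [Field K] where
  L : ℕ
  a : K[X][Y]
  b : K[X][Y]
  c₀ : K[X][Y]
  c : Fin L → K[X][Y]
  e : Fin L → K
  b_ne : b ≠ 0
  c₀_ne : c₀ ≠ 0
  c_ne : ∀ l, c l ≠ 0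
  e_ne : ∀ l, e l ≠ 0
  nontrivial_x : max (degX a) (degX b) + ∑ l, degX (c l) ≠ 0
  nontrivial_y : max (degY a) (degY b) + ∑ l, degY (c l) ≠ 0

namespace TermData

variable {K : Type*} [Field K]

/-- `h` is an element `c₀ exp(a/b) ∏ c_ℓ ^ e_ℓ` of `E`. -/
def IsTerm {E : Type*} [Field E] [Algebra (RatXY K) E] (H : TermData K) (D : DiffExt K E)
    (h : E) : Prop :=
  ∃ (g : E) (u : Fin H.L → E),
    IsExp D (emb E H.a / emb E H.b) g ∧
    (∀ l, IsPow D (emb E (H.c l)) (emb E (C (C (H.e l)))) (u l)) ∧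
    h = emb E H.c₀ * g * ∏ l, u l

variable (H : TermData K)

def alpha : ℕ := degX (sqfreePart H.b) + degX H.b + ∑ l, degX (H.c l)

def beta : ℤ := (degX H.a : ℤ) - degX H.b - 1

def gamma : ℕ := degY (sqfreePart H.b) + max (degY H.a) (degY H.b) + ∑ l, degY (H.c l)

def omega : K := (degX H.c₀ : K) + ∑ l, H.e l * (degX (H.c l) : K)

/-- `(lc_x a)/(lc_x b) ∈ K`. -/
def LcQuotConst : Prop := ∃ k : K, lcX H.a = C k * lcX H.b

open Classical in
def phi1 : ℕ := if H.LcQuotConst then 1 else 0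

open Classical in
def phi2 : ℕ := if H.LcQuotConst ∧ H.beta = 0 then 1 else 0

/-- The three conditions: `a/b ∈ K(x)`; `deg_y c_ℓ = 0` or `e_ℓ ∈ ℤ` for all `ℓ`; and
`deg_y c₀ + ∑ e_ℓ deg_y c_ℓ ≥ -1` (by the second condition the sum is an integer). -/
def RationalInY : Prop :=
  (∃ p q : K[X], q ≠ 0 ∧ H.a * C q = H.b * C p) ∧
  (∀ l, degY (H.c l) = 0 ∨ ∃ m : ℤ, H.e l = (m : K)) ∧
  ∃ s : ℤ, ∑ l, H.e l * (degY (H.c l) : K) = (s : K) ∧ -1 ≤ (degY H.c₀ : ℤ) + s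

open Classical in
def phi3 : ℕ := if H.RationalInY then 1 else 0

def psi : ℤ := (H.gamma : ℤ) + H.phi3 - 2

/-- `ϑ` in the case `deg_x a > deg_x b`. -/
def theta1 : ℚ :=
  ((H.alpha : ℚ) + H.beta) * (2 * (H.gamma : ℚ) - 1 + H.phi3) + H.gamma - 1

/-- `φ` in the case `deg_x a > deg_x b`. -/
def varphi1 : ℚ :=
  (degX H.c₀ : ℚ) + ((H.alpha : ℚ) + H.beta + 1) * degY H.c₀
    + ((H.gamma : ℚ) - 2 + H.phi3) * ((degX H.c₀ : ℚ) - H.alpha - H.beta - H.phi2)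
    - (1 - (H.phi2 : ℚ)) * max 0 ((H.gamma : ℚ) - 2 + H.phi3)
      * ((H.phi1 : ℚ) + 1 / 2 * H.beta * ((H.gamma : ℚ) - 1 + H.phi3))

/-- `ϑ` in the case `deg_x a ≤ deg_x b`. -/
def theta2 : ℚ := (H.alpha : ℚ) * (2 * (H.gamma : ℚ) - 1 + H.phi3) - 1

/-- `φ` in the case `deg_x a ≤ deg_x b`. -/
def varphi2 : ℚ :=
  (degX H.c₀ : ℚ) + (H.alpha : ℚ) * degY H.c₀
    + ((H.gamma : ℚ) - 2 + H.phi3) * ((degX H.c₀ : ℚ) + 1 - H.alpha)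
    - 1 / 2 * max 0 ((H.gamma : ℚ) - 2 + H.phi3) * ((H.gamma : ℚ) + 1 + H.phi3)

/-- The improved constant `φ'`, as a function of `δ` and of the natural number `n = ω`. -/
def varphi2' (δ : ℤ) (n : ℕ) : ℚ :=
  H.varphi2 - (δ : ℚ) * ((H.gamma : ℚ) - 2 + H.phi3 - n) + 1

end TermData

end CreativeTelescoping

end

/-! Write h = c₀ g with D_x g = (u/v) g and D_y g = (u'/v) g, where v is b b* ∏ c_ℓ, possibly after
removing a factor common to u, u' and v. For P = ∑ pᵢ D_xⁱ of order at most r, P h = (T/v^r) g with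
T linear in P (`telNum`). For Q = s g / v^(r-1), D_y Q = (S/v^r) g with S linear in s (`certOp`).
Equating T and S gives a homogeneous linear system over K in the coefficients of the pᵢ and of s.
More unknowns than equations force a nonzero solution (`exists_telNum_eq_certOp`), and the bound on
d is this count.

The solution must have P ≠ 0, so s has to avoid the kernel of `certOp`. All nonzero kernel elements
have the same y-degree, so giving up one power of y suffices (`hasFreeExponents_one`). A kernel
element writes -D_y(a/b) as a combination of logarithmic derivatives. Comparing poles and residues
in y, with the degree bound on s, yields the condition behind φ₃, unless u, u', v share a factor of
positive y-degree; cancelling that factor pays for the lost power (`exists_prime_of_certOp_eq_zero`,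
`exists_cancelled`).

The x-degree bounds for the numerators of D_xⁱ h vary linearly with i, so shortening some of the pᵢ
can save more equations than it costs unknowns. If deg_x a > deg_x b, the pᵢ with large i are
shortened (`hasRelation_of_degX_le`). Otherwise h behaves like x^ω at infinity, the pᵢ with small i
are shortened, and the top coefficients in x are all K-multiples of one polynomial in y, so that a
single scalar equation replaces a whole column of equations (`hasRelation_of_top`). If ω ∈ ℕ, then
D_x^(ω+1) kills the powers x^ω, …, x^0, and the numerators of higher order drop by a further ω + 1
(`hasRelation_of_nat`). -/

noncomputable section

namespace CreativeTelescoping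

/-! ### Partial derivatives and partial degrees of bivariate polynomials. -/

section PartialDerivative

variable {K : Type*} [Field K]

/-- The partial derivative of a bivariate polynomial with respect to the inner variable. -/
def dX : Derivation K K[X][Y] K[X][Y] :=
  Derivation.mk'
    ((Bivariate.swap (R := K)).toLinearMap ∘ₗ
      ((derivative (R := K[X])).restrictScalars K) ∘ₗ (Bivariate.swap (R := K)).toLinearMap)
    (fun p q => by
      simp only [LinearMap.comp_apply, AlgEquiv.toLinearMap_apply, LinearMap.restrictScalars_apply,
        map_mul, derivative_mul, map_add, Bivariate.swap_swap_apply, smul_eq_mul]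
      ring)

theorem dX_apply (p : K[X][Y]) : dX p = Bivariate.swap (derivative (Bivariate.swap p)) := rfl

@[simp] theorem swap_dX (p : K[X][Y]) :
    Bivariate.swap (dX p) = derivative (Bivariate.swap p) := by
  rw [dX_apply, Bivariate.swap_swap_apply]

theorem dX_C (q : K[X]) : dX (C q : K[X][Y]) = C (derivative q) := by
  rw [dX_apply, Bivariate.swap_C, derivative_map, Bivariate.swap_map_C]

@[simp] theorem dX_X : dX (X : K[X][Y]) = 0 := by
  rw [dX_apply, Bivariate.swap_Y, derivative_C, map_zero]

theorem coeff_coeff_swap (p : K[X][Y]) (i j : ℕ) :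
    ((Bivariate.swap p).coeff j).coeff i = (p.coeff i).coeff j := by
  induction p using Polynomial.induction_on' with
  | add p q hp hq => simp [hp, hq]
  | monomial n f =>
    induction f using Polynomial.induction_on' with
    | add f g hf hg => simp only [map_add, coeff_add, hf, hg]
    | monomial m k =>
      rw [Bivariate.swap_monomial_monomial]
      simp only [coeff_monomial]
      split_ifs <;> simp_all [coeff_monomial]

theorem coeff_dX (p : K[X][Y]) (i : ℕ) : (dX p).coeff i = derivative (p.coeff i) := by
  ext j
  rw [← coeff_coeff_swap, swap_dX, coeff_derivative, coeff_derivative, ← coeff_coeff_swap]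
  rw [show ((j : K[X]) + 1) = C ((j : K) + 1) by simp, coeff_mul_C]

theorem natDegree_dX_le (p : K[X][Y]) : (dX p).natDegree ≤ p.natDegree := by
  rw [natDegree_le_iff_coeff_eq_zero]
  intro n hn
  rw [coeff_dX, coeff_eq_zero_of_natDegree_lt hn, derivative_zero]

theorem swap_ne_zero {p : K[X][Y]} (hp : p ≠ 0) : Bivariate.swap p ≠ 0 := by
  simpa using hp

theorem natDegree_coeff_le_degX (p : K[X][Y]) (i : ℕ) : (p.coeff i).natDegree ≤ degX p := by
  rw [natDegree_le_iff_coeff_eq_zero]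
  intro n hn
  rw [← coeff_coeff_swap, coeff_eq_zero_of_natDegree_lt hn, coeff_zero]

theorem degX_le_of_natDegree_coeff_le {p : K[X][Y]} {d : ℕ}
    (h : ∀ i, (p.coeff i).natDegree ≤ d) : degX p ≤ d := by
  rw [degX, natDegree_le_iff_coeff_eq_zero]
  intro n hn
  ext i
  rw [coeff_coeff_swap, coeff_eq_zero_of_natDegree_lt ((h i).trans_lt hn), coeff_zero]

theorem degX_mul {p q : K[X][Y]} (hp : p ≠ 0) (hq : q ≠ 0) :
    degX (p * q) = degX p + degX q := by
  rw [degX, map_mul, natDegree_mul (swap_ne_zero hp) (swap_ne_zero hq)]; rfl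

theorem degX_prod {ι : Type*} (s : Finset ι) (f : ι → K[X][Y]) (h : ∀ i ∈ s, f i ≠ 0) :
    degX (∏ i ∈ s, f i) = ∑ i ∈ s, degX (f i) := by
  rw [degX, map_prod, natDegree_prod _ _ fun i hi => swap_ne_zero (h i hi)]; rfl

theorem derivative_ne_zero [CharZero K] {p : K[X][Y]} (hp : p.natDegree ≠ 0) :
    derivative p ≠ 0 := fun h => hp (Polynomial.derivative_eq_zero.1 h)

end PartialDerivative

/-! ### Polynomials and rational multiples of g inside E. -/

section Embedding

variable {K E : Type*} [Field K] [Field E] [Algebra (RatXY K) E]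

variable (E) in
/-- The embedding `emb` as a ring homomorphism. -/
def embHom : K[X][Y] →+* E := (algebraMap (RatXY K) E).comp (algebraMap K[X][Y] (RatXY K))

theorem emb_eq (p : K[X][Y]) : emb E p = embHom E p := rfl

theorem embHom_injective : Function.Injective (embHom (K := K) E) :=
  (algebraMap (RatXY K) E).injective.comp (IsFractionRing.injective _ _)

theorem embHom_ne_zero {p : K[X][Y]} (hp : p ≠ 0) : embHom E p ≠ 0 := by
  rwa [Ne, map_eq_zero_iff _ embHom_injective]

theorem embHom_mem_range (p : K[X][Y]) :
    embHom E p ∈ (algebraMap (RatXY K) E).fieldRange := ⟨_, rfl⟩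

theorem exists_embHom_div {z : E} (hz : z ∈ (algebraMap (RatXY K) E).fieldRange) :
    ∃ p q : K[X][Y], q ≠ 0 ∧ z = embHom E p / embHom E q := by
  obtain ⟨w, rfl⟩ := hz
  obtain ⟨p, q, hq, rfl⟩ := IsFractionRing.div_surjective (A := K[X][Y]) w
  exact ⟨p, q, nonZeroDivisors.ne_zero hq, map_div₀ _ _ _⟩

/-- A derivation on K[x,y] is determined by its values on K, x and y. -/
theorem derivation_embHom {δ : Derivation ℤ E E} {d : Derivation K K[X][Y] K[X][Y]}
    (hc : ∀ k : K, δ (embHom E (C (C k))) = 0)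
    (hx : δ (embHom E (C X : K[X][Y])) = embHom E (d (C X)))
    (hy : δ (embHom E (X : K[X][Y])) = embHom E (d X)) (p : K[X][Y]) :
    δ (embHom E p) = embHom E (d p) := by
  have hC : ∀ q : K[X], δ (embHom E (C q)) = embHom E (d (C q)) := by
    intro q
    induction q using Polynomial.induction_on with
    | C k =>
      have : d (C (C k)) = 0 := by
        have := d.map_algebraMap k
        exact this
      rw [hc, this, map_zero]
    | add p q hp hq => simp only [map_add, hp, hq]
    | monomial n k ih =>
      rw [pow_succ, ← mul_assoc, C_mul, map_mul, δ.leibniz, ih, hx, d.leibniz]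
      simp only [smul_eq_mul, map_add, map_mul]
  induction p using Polynomial.induction_on with
  | C q => exact hC q
  | add p q hp hq => simp only [map_add, hp, hq]
  | monomial n q ih =>
    rw [pow_succ, ← mul_assoc, map_mul, δ.leibniz, ih, hy, d.leibniz (C q * X ^ n)]
    simp only [smul_eq_mul, map_add, map_mul]

theorem DiffExt.Dx_embHom (D : DiffExt K E) (p : K[X][Y]) :
    D.Dx (embHom E p) = embHom E (dX p) := by
  refine derivation_embHom D.Dx_const ?_ ?_ p
  · rw [dX_C, derivative_X, C_1, map_one]; exact D.Dx_x
  · rw [dX_X, map_zero]; exact D.Dx_y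

/-- The partial derivative of a bivariate polynomial with respect to the outer variable. -/
def dY : Derivation K K[X][Y] K[X][Y] := (derivative' (R := K[X])).restrictScalars K

theorem dY_apply (p : K[X][Y]) : dY p = derivative p := rfl

theorem DiffExt.Dy_embHom (D : DiffExt K E) (p : K[X][Y]) :
    D.Dy (embHom E p) = embHom E (derivative p) := by
  refine derivation_embHom (d := dY) D.Dy_const ?_ ?_ p
  · rw [dY_apply, derivative_C, map_zero]; exact D.Dy_x
  · rw [dY_apply, derivative_X, map_one]; exact D.Dy_y

/-- If `g` is an exponential with rational logarithmic derivatives, every rational multiple of `g`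
is zero or hyperexponential. -/
theorem isHyperexponential_mul {D : DiffExt K E} {g : E} (hg : g ≠ 0) {v u u' : K[X][Y]}
    (hx : D.Dx g = embHom E u / embHom E v * g)
    (hy : D.Dy g = embHom E u' / embHom E v * g) {z : E}
    (hz : z ∈ (algebraMap (RatXY K) E).fieldRange) :
    z * g = 0 ∨ IsHyperexponential D (z * g) := by
  rcases eq_or_ne z 0 with rfl | h0
  · left; simp
  right
  obtain ⟨p, q, hq, rfl⟩ := exists_embHom_div hz
  have hq' := embHom_ne_zero (E := E) hq
  have hp' : embHom E p ≠ 0 := fun h => h0 (by rw [h, zero_div])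
  have mem := fun p : K[X][Y] => embHom_mem_range (E := E) p
  refine ⟨mul_ne_zero h0 hg, ?_, ?_⟩
  · have : D.Dx (embHom E p / embHom E q * g) / (embHom E p / embHom E q * g) =
        embHom E (dX p) / embHom E p - embHom E (dX q) / embHom E q
          + embHom E u / embHom E v := by
      rw [D.Dx.leibniz, D.Dx.leibniz_div, hx]
      simp only [D.Dx_embHom, smul_eq_mul]
      field_simp
      ring
    rw [this]
    exact add_mem (sub_mem (div_mem (mem _) (mem _)) (div_mem (mem _) (mem _)))
      (div_mem (mem _) (mem _))
  · have : D.Dy (embHom E p / embHom E q * g) / (embHom E p / embHom E q * g) =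
        embHom E (derivative p) / embHom E p - embHom E (derivative q) / embHom E q
          + embHom E u' / embHom E v := by
      rw [D.Dy.leibniz, D.Dy.leibniz_div, hy]
      simp only [D.Dy_embHom, smul_eq_mul]
      field_simp
      ring
    rw [this]
    exact add_mem (sub_mem (div_mem (mem _) (mem _)) (div_mem (mem _) (mem _)))
      (div_mem (mem _) (mem _))

theorem Dx_rational_mul {D : DiffExt K E} {g : E} {v u : K[X][Y]}
    (hx : D.Dx g = embHom E u / embHom E v * g) {z : E}
    (hz : z ∈ (algebraMap (RatXY K) E).fieldRange) :
    ∃ z' ∈ (algebraMap (RatXY K) E).fieldRange, D.Dx (z * g) = z' * g := by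
  obtain ⟨p, q, hq, rfl⟩ := exists_embHom_div hz
  have mem := fun p : K[X][Y] => embHom_mem_range (E := E) p
  refine ⟨(embHom E q)⁻¹ ^ 2 * (embHom E q * embHom E (dX p) - embHom E p * embHom E (dX q))
    + embHom E p / embHom E q * (embHom E u / embHom E v), ?_, ?_⟩
  · exact add_mem (mul_mem (pow_mem (inv_mem (mem _)) _)
      (sub_mem (mul_mem (mem _) (mem _)) (mul_mem (mem _) (mem _))))
      (mul_mem (div_mem (mem _) (mem _)) (div_mem (mem _) (mem _)))
  · rw [D.Dx.leibniz, D.Dx.leibniz_div, hx]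
    simp only [D.Dx_embHom, smul_eq_mul]
    ring

end Embedding

/-! ### Differential operators in D_x and telescopers of exact order and degree. -/

section Operators

variable {K E : Type*} [Field K] [Field E] [Algebra (RatXY K) E]

/-- The action on `f` of the differential operator `∑ pᵢ D_x ^ i` with symbol `∑ pᵢ Y ^ i`. -/
def act (D : DiffExt K E) (p : K[X][Y]) (f : E) : E :=
  p.sum fun i q => embHom E (C q) * (D.Dx)^[i] f

theorem act_eq_sum_range (D : DiffExt K E) {p : K[X][Y]} {n : ℕ} (hn : p.natDegree < n) (f : E) :
    act D p f = ∑ i ∈ Finset.range n, embHom E (C (p.coeff i)) * (D.Dx)^[i] f :=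
  sum_over_range' p (by simp) n hn

/-- The commutation rule D_x q = q D_x + q' turns composition with D_x into multiplication of the
symbol by Y plus the x-derivative of its coefficients. -/
theorem Dx_act (D : DiffExt K E) (p : K[X][Y]) (f : E) :
    D.Dx (act D p f) = act D (X * p + dX p) f := by
  have hle : (X * p + dX p).natDegree < p.natDegree + 2 := by
    have h1 : (X * p).natDegree ≤ 1 + p.natDegree :=
      natDegree_mul_le.trans (by rw [natDegree_X])
    have h2 := natDegree_dX_le p
    have := natDegree_add_le (X * p) (dX p)
    omega
  rw [act_eq_sum_range D hle, act_eq_sum_range D (show p.natDegree < p.natDegree + 2 by omega),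
    map_sum]
  have hstep : ∀ i, D.Dx (embHom E (C (p.coeff i)) * (D.Dx)^[i] f) =
      embHom E (C (p.coeff i)) * (D.Dx)^[i + 1] f
        + embHom E (C ((dX p).coeff i)) * (D.Dx)^[i] f := by
    intro i
    rw [D.Dx.leibniz, D.Dx_embHom, dX_C, coeff_dX, Function.iterate_succ_apply']
    simp only [smul_eq_mul]
    ring
  simp only [hstep, coeff_add, map_add, add_mul, Finset.sum_add_distrib]
  congr 1
  rw [Finset.sum_range_succ, Finset.sum_range_succ' _ (p.natDegree + 1)]
  simp [coeff_X_mul]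

theorem C_mul_act (D : DiffExt K E) (q : K[X]) (p : K[X][Y]) (f : E) :
    embHom E (C q) * act D p f = act D (C q * p) f := by
  have hle : (C q * p).natDegree < p.natDegree + 1 :=
    Nat.lt_succ_of_le (natDegree_C_mul_le q p)
  rw [act_eq_sum_range D hle, act_eq_sum_range D (Nat.lt_succ_self _), Finset.mul_sum]
  refine Finset.sum_congr rfl fun i _ => ?_
  rw [coeff_C_mul, C_mul, map_mul, mul_assoc]

theorem hasRelation_of_act {D : DiffExt K E} {f Q : E} {p : K[X][Y]} (hp : p ≠ 0)
    (hQ : Q = 0 ∨ IsHyperexponential D Q) (h : act D p f = D.Dy Q) :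
    HasRelation D f p.natDegree (degX p) := by
  refine ⟨fun i => p.coeff i, ?_, ?_, Q, hQ, ?_⟩
  · simpa using hp
  · apply le_antisymm
    · exact Finset.sup_le fun i _ => natDegree_coeff_le_degX p i
    · apply degX_le_of_natDegree_coeff_le
      intro i
      rcases lt_or_ge p.natDegree i with hi | hi
      · simp [coeff_eq_zero_of_natDegree_lt hi]
      · exact Finset.le_sup (f := fun i : Fin (p.natDegree + 1) => (p.coeff i).natDegree)
          (Finset.mem_univ ⟨i, Nat.lt_succ_of_le hi⟩)
  · rw [← h, act_eq_sum_range D (Nat.lt_succ_self _), Finset.sum_range]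
    rfl

/-- A nonzero telescoper of order at most `r` and degree at most `d` whose certificate is a rational
multiple of `g` can be turned into a relation of order exactly `r` and degree exactly `d`. -/
theorem hasRelation_of_le {D : DiffExt K E} {g : E} (hg : g ≠ 0) {v u u' : K[X][Y]}
    (hx : D.Dx g = embHom E u / embHom E v * g)
    (hy : D.Dy g = embHom E u' / embHom E v * g) {f z : E}
    (hz : z ∈ (algebraMap (RatXY K) E).fieldRange) {p : K[X][Y]} (hp : p ≠ 0)
    (h : act D p f = D.Dy (z * g)) {r d : ℕ} (hr : p.natDegree ≤ r) (hd : degX p ≤ d) :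
    HasRelation D f r d := by
  obtain ⟨m, rfl⟩ := Nat.exists_eq_add_of_le hr
  obtain ⟨n, rfl⟩ := Nat.exists_eq_add_of_le hd
  clear hr hd
  -- Composing with D_x raises the order by one and keeps the degree in x; multiplying by x raises
  -- the degree by one and keeps the order. The certificate becomes D_x Q or x Q, again a rational
  -- multiple of g.
  induction m generalizing p z with
  | succ m ih =>
    obtain ⟨z', hz', e⟩ := Dx_rational_mul hx hz
    have hdeg : (X * p + dX p).natDegree = p.natDegree + 1 := by
      rw [natDegree_add_eq_left_of_natDegree_lt, natDegree_X_mul hp]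
      rw [natDegree_X_mul hp]
      exact Nat.lt_succ_of_le (natDegree_dX_le p)
    have hdegX : degX (X * p + dX p) = degX p := by
      have hsw : (C X * Bivariate.swap p : K[X][Y]).natDegree = (Bivariate.swap p).natDegree :=
        natDegree_C_mul X_ne_zero
      rw [degX, map_add, map_mul, Bivariate.swap_Y, swap_dX, degX]
      rcases Nat.eq_zero_or_pos (Bivariate.swap p).natDegree with h0 | h0
      · rw [derivative_of_natDegree_zero h0, add_zero, hsw]
      · rw [natDegree_add_eq_left_of_natDegree_lt, hsw]
        rw [hsw]
        exact natDegree_derivative_lt h0.ne'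
    have hne : X * p + dX p ≠ 0 := by
      intro h0
      rw [h0, natDegree_zero] at hdeg
      omega
    have hact : act D (X * p + dX p) f = D.Dy (z' * g) := by
      rw [← Dx_act, h, ← e, D.comm]
    have := ih hz' hne hact
    rwa [hdeg, hdegX, add_right_comm, add_assoc] at this
  | zero =>
    induction n generalizing p z with
    | succ n ih =>
      have hX : (C X : K[X][Y]) ≠ 0 := C_ne_zero.2 X_ne_zero
      have hXp : C X * p ≠ 0 := mul_ne_zero hX hp
      have hdegX : degX (C X * p) = degX p + 1 := by
        rw [degX_mul hX hp, add_comm]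
        simp only [degX, Bivariate.swap_X, natDegree_X]
      have hact : act D (C X * p) f = D.Dy ((embHom E (C X : K[X][Y]) * z) * g) := by
        rw [← C_mul_act, h, mul_assoc, D.Dy.leibniz (embHom E (C X)), D.Dy_embHom]
        simp
      have := ih (mul_mem (embHom_mem_range _) hz) hXp hact
      rwa [natDegree_C_mul (X_ne_zero (R := K)), hdegX, add_right_comm, add_assoc] at this
    | zero => exact hasRelation_of_act hp (isHyperexponential_mul hg hx hy hz) h

end Operators

/-! ### The linear ansatz for telescoper and certificate. -/

section Ansatz

variable {K E : Type*} [Field K] [Field E] [Algebra (RatXY K) E]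

/-- The numerators `Nᵢ` in `D_x ^ i (c * g) = Nᵢ / v ^ i * g` when `D_x g = u / v * g`. -/
def numer (c v u : K[X][Y]) : ℕ → K[X][Y]
  | 0 => c
  | i + 1 => dX (numer c v u i) * v + numer c v u i * (u - (i : K[X][Y]) * dX v)

theorem Dx_div_pow_mul {D : DiffExt K E} {g : E} {v u : K[X][Y]} (hv : v ≠ 0)
    (hx : D.Dx g = embHom E u / embHom E v * g) (p : K[X][Y]) (i : ℕ) :
    D.Dx (embHom E p / embHom E v ^ i * g) =
      embHom E (dX p * v + p * (u - (i : K[X][Y]) * dX v)) / embHom E v ^ (i + 1) * g := by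
  have hv' := embHom_ne_zero (E := E) hv
  rw [D.Dx.leibniz, D.Dx.leibniz_div, hx, D.Dx.leibniz_pow]
  simp only [D.Dx_embHom, smul_eq_mul, nsmul_eq_mul, map_add, map_mul, map_sub, map_natCast]
  rcases i with _ | i
  · simp only [pow_zero, Nat.cast_zero]
    field_simp
    ring
  · simp only [Nat.add_sub_cancel]
    field_simp
    ring

theorem iterate_Dx {D : DiffExt K E} {g : E} {v u : K[X][Y]} (hv : v ≠ 0)
    (hx : D.Dx g = embHom E u / embHom E v * g) (c : K[X][Y]) (i : ℕ) :
    (D.Dx)^[i] (embHom E c * g) = embHom E (numer c v u i) / embHom E v ^ i * g := by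
  induction i with
  | zero => simp [numer]
  | succ i ih => rw [Function.iterate_succ_apply', ih, Dx_div_pow_mul hv hx, numer]

/-- The map `s ↦ v ^ r / g * D_y (s * g / v ^ (r - 1))` for `D_y g = u' / v * g`. -/
def certOp (v u' : K[X][Y]) (r : ℕ) : K[X][Y] →ₗ[K] K[X][Y] :=
  LinearMap.mulLeft K v ∘ₗ dY.toLinearMap
    + LinearMap.mulLeft K (u' - ((r : K[X][Y]) - 1) * derivative v)

theorem certOp_apply (v u' : K[X][Y]) (r : ℕ) (s : K[X][Y]) :
    certOp v u' r s = v * derivative s + (u' - ((r : K[X][Y]) - 1) * derivative v) * s := rfl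

/-- The certificate s g / v^(r-1) is written as s v / v^r, so that r = 0 needs no separate
treatment. -/
theorem Dy_certificate {D : DiffExt K E} {g : E} {v u' : K[X][Y]} (hv : v ≠ 0)
    (hy : D.Dy g = embHom E u' / embHom E v * g) (r : ℕ) (s : K[X][Y]) :
    D.Dy (embHom E s * embHom E v / embHom E v ^ r * g) =
      embHom E (certOp v u' r s) / embHom E v ^ r * g := by
  have hv' := embHom_ne_zero (E := E) hv
  rw [D.Dy.leibniz, D.Dy.leibniz_div, hy, D.Dy.leibniz_pow, D.Dy.leibniz]
  simp only [D.Dy_embHom, smul_eq_mul, nsmul_eq_mul, map_add, map_mul, map_sub, map_natCast,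
    certOp_apply, map_one]
  rcases r with _ | r
  · simp only [pow_zero, Nat.cast_zero]
    field_simp
    ring
  · simp only [Nat.add_sub_cancel, Nat.cast_add, Nat.cast_one]
    field_simp
    ring

/-- The polynomial `v ^ r / g * P (c * g)` for the operator `P` with symbol `p`, of order at
most `r`. -/
def telNum (c v u : K[X][Y]) (r : ℕ) : K[X][Y] →ₗ[K] K[X][Y] :=
  ∑ i ∈ Finset.range (r + 1), LinearMap.mulRight K (numer c v u i * v ^ (r - i)) ∘ₗ
    (Algebra.linearMap K[X] K[X][Y]).restrictScalars K ∘ₗ (lcoeff K[X] i).restrictScalars K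

theorem telNum_apply (c v u : K[X][Y]) (r : ℕ) (p : K[X][Y]) :
    telNum c v u r p =
      ∑ i ∈ Finset.range (r + 1), C (p.coeff i) * (numer c v u i * v ^ (r - i)) := by
  simp [telNum, LinearMap.sum_apply, mul_assoc]

theorem act_eq_telNum {D : DiffExt K E} {g : E} {v u : K[X][Y]} (hv : v ≠ 0)
    (hx : D.Dx g = embHom E u / embHom E v * g) (c : K[X][Y]) {r : ℕ} {p : K[X][Y]}
    (hp : p.natDegree ≤ r) :
    act D p (embHom E c * g) = embHom E (telNum c v u r p) / embHom E v ^ r * g := by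
  have hv' := embHom_ne_zero (E := E) hv
  rw [act_eq_sum_range D (Nat.lt_succ_of_le hp), telNum_apply, map_sum, Finset.sum_div,
    Finset.sum_mul]
  refine Finset.sum_congr rfl fun i hi => ?_
  have hir : i + (r - i) = r := by
    have := Finset.mem_range.1 hi
    omega
  rw [iterate_Dx hv hx, map_mul, map_mul, map_pow]
  conv_rhs => rw [← hir, pow_add, hir]
  field_simp

/-- Polynomials with prescribed `y`-exponents in `I` and prescribed bounds for the `x`-degrees of
their coefficients, parametrized by the coefficients. -/
theorem exists_linearMap_box (I : Finset ℕ) (m : ℕ → ℕ) :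
    ∃ ι : (∀ i : I, Fin (m i) → K) →ₗ[K] K[X][Y], Function.Injective ι ∧
      ∀ x, (∀ i ∉ I, (ι x).coeff i = 0) ∧ ∀ i, ((ι x).coeff i).degree < m i := by
  let ι : (∀ i : I, Fin (m i) → K) →ₗ[K] K[X][Y] :=
    ∑ i : I, (monomial (R := K[X]) (i : ℕ)).restrictScalars K ∘ₗ (degreeLT K (m i)).subtype ∘ₗ
      (degreeLTEquiv K (m i)).symm.toLinearMap ∘ₗ LinearMap.proj i
  have hι : ∀ x, ι x = ∑ i : I, monomial (i : ℕ) ((degreeLTEquiv K (m i)).symm (x i) : K[X]) :=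
    fun x => by simp [ι, LinearMap.sum_apply]
  have hcoeff : ∀ x (i : I), (ι x).coeff i = ((degreeLTEquiv K (m i)).symm (x i) : K[X]) := by
    intro x i
    rw [hι, finsetSum_coeff, Finset.sum_eq_single i]
    · simp
    · intro j _ hj
      rw [coeff_monomial, if_neg fun h => hj (Subtype.ext h)]
    · simp
  have hout : ∀ x, ∀ i ∉ I, (ι x).coeff i = 0 := by
    intro x i hi
    rw [hι, finsetSum_coeff]
    refine Finset.sum_eq_zero fun j _ => ?_
    rw [coeff_monomial, if_neg fun h : (j : ℕ) = i => hi (h ▸ j.2)]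
  refine ⟨ι, ?_, fun x => ⟨hout x, fun i => ?_⟩⟩
  · intro x y hxy
    funext i
    have := (hcoeff x i).symm.trans ((congrArg (fun p => coeff p (i : ℕ)) hxy).trans (hcoeff y i))
    exact (degreeLTEquiv K (m i)).symm.injective (Subtype.ext this)
  · by_cases hi : i ∈ I
    · rw [hcoeff x ⟨i, hi⟩]
      exact mem_degreeLT.1 (Subtype.mem _)
    · rw [hout x i hi, degree_zero]
      exact WithBot.bot_lt_coe _

/-- Comparing the number of unknowns with the number of linear equations. -/
theorem exists_telNum_eq_certOp (c v u u' : K[X][Y]) (r : ℕ) (m : ℕ → ℕ) {k : ℕ}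
    (Λ : Fin k → K[X][Y] →ₗ[K] K) (Ex Ey Sx : ℕ) (J : Finset ℕ)
    (htel : ∀ p : K[X][Y], (∀ i, (p.coeff i).degree < m i) → (∀ j, Λ j p = 0) →
      (Bivariate.swap (telNum c v u r p)).degree < Ex ∧ (telNum c v u r p).degree < Ey)
    (hcert : ∀ s : K[X][Y], (∀ i ∉ J, s.coeff i = 0) → (∀ i, (s.coeff i).degree < Sx) →
      (Bivariate.swap (certOp v u' r s)).degree < Ex ∧ (certOp v u' r s).degree < Ey)
    (hinj : ∀ s : K[X][Y], (∀ i ∉ J, s.coeff i = 0) → (∀ i, (s.coeff i).degree < Sx) →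
      certOp v u' r s = 0 → s = 0)
    (hcount : Ex * Ey + k < (∑ i ∈ Finset.range (r + 1), m i) + Sx * J.card) :
    ∃ p s : K[X][Y], p ≠ 0 ∧ p.natDegree ≤ r ∧ (∀ i, (p.coeff i).degree < m i) ∧
      telNum c v u r p = certOp v u' r s := by
  obtain ⟨ι, hι, hι'⟩ := exists_linearMap_box (K := K) (Finset.range (r + 1)) m
  obtain ⟨κ, hκ, hκ'⟩ := exists_linearMap_box (K := K) J fun _ => Sx
  let F : ((∀ i : Finset.range (r + 1), Fin (m i) → K) × (∀ _ : J, Fin Sx → K)) →ₗ[K] K[X][Y] :=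
    telNum c v u r ∘ₗ ι ∘ₗ LinearMap.fst K _ _ - certOp v u' r ∘ₗ κ ∘ₗ LinearMap.snd K _ _
  let Φ : ((∀ i : Finset.range (r + 1), Fin (m i) → K) × (∀ _ : J, Fin Sx → K)) →ₗ[K]
      ((Fin Ey → Fin Ex → K) × (Fin k → K)) :=
    (LinearMap.pi fun j : Fin Ey => LinearMap.pi fun i : Fin Ex =>
      lcoeff K (i : ℕ) ∘ₗ (lcoeff K[X] (j : ℕ)).restrictScalars K ∘ₗ F).prod
    (LinearMap.pi fun j => Λ j ∘ₗ ι ∘ₗ LinearMap.fst K _ _)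
  -- The map `Φ` reads off the Ex · Ey coefficients of the difference together with the k side
  -- conditions; by `hcount` its domain has larger dimension than its codomain.
  have hker : LinearMap.ker Φ ≠ ⊥ := by
    apply LinearMap.ker_ne_bot_of_finrank_lt
    simp only [Module.finrank_prod, Module.finrank_pi_fintype, Module.finrank_self,
      Finset.sum_const, Finset.card_univ, Fintype.card_fin, smul_eq_mul, mul_one,
      Fintype.card_coe]
    rw [Finset.sum_coe_sort (Finset.range (r + 1)) m]
    linarith [mul_comm Ex Ey, mul_comm Sx J.card]
  obtain ⟨⟨x, y⟩, hxy, hne⟩ := Submodule.exists_mem_ne_zero_of_ne_bot hker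
  have hΦ : Φ (x, y) = 0 := hxy
  have hΛ : ∀ j, Λ j (ι x) = 0 := fun j => congrFun (congrArg Prod.snd hΦ) j
  have hbox : ∀ (j : Fin Ey) (i : Fin Ex), ((F (x, y)).coeff j).coeff i = 0 := fun j i =>
    congrFun (congrFun (congrArg Prod.fst hΦ) j) i
  obtain ⟨ht1, ht2⟩ := htel (ι x) (hι' x).2 hΛ
  obtain ⟨hc1, hc2⟩ := hcert (κ y) (hκ' y).1 (hκ' y).2
  have hF : F (x, y) = telNum c v u r (ι x) - certOp v u' r (κ y) := rfl
  have hF0 : F (x, y) = 0 := by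
    ext j i
    rw [coeff_zero, coeff_zero]
    rcases lt_or_ge j Ey with hj | hj
    · rcases lt_or_ge i Ex with hi | hi
      · exact hbox ⟨j, hj⟩ ⟨i, hi⟩
      · have hi' : (Ex : WithBot ℕ) ≤ i := by exact_mod_cast hi
        rw [← coeff_coeff_swap, hF, map_sub, coeff_sub,
          coeff_eq_zero_of_degree_lt (ht1.trans_le hi'),
          coeff_eq_zero_of_degree_lt (hc1.trans_le hi'), sub_zero, coeff_zero]
    · have hj' : (Ey : WithBot ℕ) ≤ j := by exact_mod_cast hj
      rw [hF, coeff_sub, coeff_eq_zero_of_degree_lt (ht2.trans_le hj'),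
        coeff_eq_zero_of_degree_lt (hc2.trans_le hj'), sub_zero, coeff_zero]
  have heq : telNum c v u r (ι x) = certOp v u' r (κ y) := sub_eq_zero.1 (hF.symm.trans hF0)
  -- If p were 0, then s would lie in the kernel of `certOp`, hence vanish by `hinj`, and the chosen
  -- kernel vector would be zero.
  refine ⟨ι x, κ y, fun h0 => hne ?_, ?_, (hι' x).2, heq⟩
  · rw [h0, map_zero] at heq
    have hy0 : y = 0 := hκ ((hinj _ (hκ' y).1 (hκ' y).2 heq.symm).trans (map_zero κ).symm)
    have hx0 : x = 0 := hι (h0.trans (map_zero ι).symm)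
    rw [hx0, hy0]
    rfl
  · rw [natDegree_le_iff_coeff_eq_zero]
    intro n hn
    exact (hι' x).1 n (by simp; omega)

theorem hasRelation_of_count {D : DiffExt K E} {g : E} (hg : g ≠ 0) {v u u' : K[X][Y]}
    (hv : v ≠ 0) (hx : D.Dx g = embHom E u / embHom E v * g)
    (hy : D.Dy g = embHom E u' / embHom E v * g) (c : K[X][Y]) {r d : ℕ} (m : ℕ → ℕ)
    (hm : ∀ i, m i ≤ d + 1) {k : ℕ}
    (Λ : Fin k → K[X][Y] →ₗ[K] K) (Ex Ey Sx : ℕ) (J : Finset ℕ)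
    (htel : ∀ p : K[X][Y], (∀ i, (p.coeff i).degree < m i) → (∀ j, Λ j p = 0) →
      (Bivariate.swap (telNum c v u r p)).degree < Ex ∧ (telNum c v u r p).degree < Ey)
    (hcert : ∀ s : K[X][Y], (∀ i ∉ J, s.coeff i = 0) → (∀ i, (s.coeff i).degree < Sx) →
      (Bivariate.swap (certOp v u' r s)).degree < Ex ∧ (certOp v u' r s).degree < Ey)
    (hinj : ∀ s : K[X][Y], (∀ i ∉ J, s.coeff i = 0) → (∀ i, (s.coeff i).degree < Sx) →
      certOp v u' r s = 0 → s = 0)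
    (hcount : Ex * Ey + k < (∑ i ∈ Finset.range (r + 1), m i) + Sx * J.card) :
    HasRelation D (embHom E c * g) r d := by
  obtain ⟨p, s, hp, hpr, hpm, h⟩ := exists_telNum_eq_certOp c v u u' r m Λ Ex Ey Sx J htel hcert
    hinj hcount
  have mem := fun p : K[X][Y] => embHom_mem_range (E := E) p
  refine hasRelation_of_le hg hx hy (div_mem (mul_mem (mem s) (mem v)) (pow_mem (mem v) r)) hp ?_
    hpr (degX_le_of_natDegree_coeff_le fun i => ?_)
  · rw [act_eq_telNum hv hx c hpr, h, Dy_certificate hv hy]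
  · have := (hpm i).trans_le (Nat.cast_le.2 (hm i))
    rcases eq_or_ne (p.coeff i) 0 with h0 | h0
    · simp [h0]
    · rw [← natDegree_lt_iff_degree_lt h0] at this
      omega

end Ansatz

/-! ### Degrees and top coefficients under one differentiation step. -/

section TopCoefficient

variable {S : Type*} [CommRing S]

theorem coeff_X_mul_derivative (p : S[X]) (n : ℕ) :
    (X * derivative p).coeff n = n * p.coeff n := by
  rcases n with _ | n
  · simp
  · rw [coeff_X_mul, coeff_derivative]
    push_cast
    ring

theorem natDegree_X_mul_derivative_le {p : S[X]} {n : ℕ} (h : p.natDegree ≤ n) :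
    (X * derivative p).natDegree ≤ n := by
  rw [natDegree_le_iff_coeff_eq_zero] at h ⊢
  intro k hk
  rw [coeff_X_mul_derivative, h k hk, mul_zero]

theorem degree_lt_of_natDegree_le_of_coeff_eq_zero {p : S[X]} {n : ℕ} (h : p.natDegree ≤ n)
    (h0 : p.coeff n = 0) : p.degree < n := by
  rw [degree_lt_iff_coeff_zero]
  intro k hk
  rcases hk.eq_or_lt with rfl | hk
  · exact h0
  · exact coeff_eq_zero_of_natDegree_lt (h.trans_lt hk)

theorem degree_lt_of_degree_X_pow_mul_lt {p : S[X]} {n k : ℕ}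
    (h : (X ^ k * p).degree < ((n + k : ℕ) : WithBot ℕ)) : p.degree < n := by
  rw [degree_lt_iff_coeff_zero] at h ⊢
  intro j hj
  rw [← coeff_X_pow_mul p k j]
  exact h _ (by omega)

theorem natDegree_le_of_natDegree_X_mul_le {p : S[X]} {n : ℕ} (h : (X * p).natDegree ≤ n + 1) :
    p.natDegree ≤ n := by
  rw [natDegree_le_iff_coeff_eq_zero] at h ⊢
  intro k hk
  rw [← coeff_X_mul p k]
  exact h _ (by omega)

/-- Top coefficients under the step `N ↦ N' V + N (U - i V')`, where `N` may be twisted by a power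
of `X`. -/
theorem natDegree_step {L V W : S[X]} {n α : ℕ} (i δ : S) (hL : L.natDegree ≤ n)
    (hV : V.natDegree ≤ α) (hW : W.natDegree ≤ α) :
    ((X * derivative L - C δ * L) * V + L * (W - C i * (X * derivative V))).natDegree ≤ n + α ∧
      ((X * derivative L - C δ * L) * V + L * (W - C i * (X * derivative V))).coeff (n + α) =
        L.coeff n * ((n - δ - i * α) * V.coeff α + W.coeff α) := by
  have h1 : (X * derivative L - C δ * L).natDegree ≤ n :=
    (natDegree_sub_le_of_le (natDegree_X_mul_derivative_le hL)
      ((natDegree_C_mul_le _ _).trans hL)).trans (by simp)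
  have h2 : (W - C i * (X * derivative V)).natDegree ≤ α :=
    (natDegree_sub_le_of_le hW
      ((natDegree_C_mul_le _ _).trans (natDegree_X_mul_derivative_le hV))).trans (by simp)
  refine ⟨(natDegree_add_le_of_le (natDegree_mul_le_of_le h1 hV)
    (natDegree_mul_le_of_le hL h2)).trans (by simp), ?_⟩
  rw [coeff_add, coeff_mul_add_eq_of_natDegree_le h1 hV, coeff_mul_add_eq_of_natDegree_le hL h2,
    coeff_sub, coeff_sub, coeff_C_mul, coeff_C_mul, coeff_X_mul_derivative, coeff_X_mul_derivative]
  ring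

end TopCoefficient

/-! ### Degree bounds for both sides of the linear system. -/

section Bounds

variable {K : Type*} [Field K]

theorem degX_derivative_le (s : K[X][Y]) : degX (derivative s) ≤ degX s := by
  refine degX_le_of_natDegree_coeff_le fun i => ?_
  rw [coeff_derivative, show ((i : K[X]) + 1) = C ((i : K) + 1) by simp]
  exact (natDegree_mul_C_le _ _).trans (natDegree_coeff_le_degX _ _)

theorem degX_lt_of_degree_coeff_lt {s : K[X][Y]} {n : ℕ} (h : ∀ i, (s.coeff i).degree < n)
    (hs : s ≠ 0) : degX s < n := by
  have hn : n ≠ 0 := by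
    rintro rfl
    refine hs (Polynomial.ext fun i => ?_)
    have := h i
    rw [coeff_zero, ← degree_eq_bot]
    simpa [Nat.WithBot.lt_zero_iff] using this
  have : degX s ≤ n - 1 := degX_le_of_natDegree_coeff_le fun i => by
    rcases eq_or_ne (s.coeff i) 0 with h0 | h0
    · simp [h0]
    · have := (natDegree_lt_iff_degree_lt h0).2 (h i)
      omega
  omega

/-- In v s' + (u' - (r-1) v') s every summand has lost one y-degree, so the y-degree grows by at
most Γ - 1. Bounding X * u' by Γ expresses this loss without truncated subtraction. The guard Sx ≠ 0
allows Sx to be the truncated difference Ex - A. -/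
theorem certOp_degree_lt {v u' : K[X][Y]} (r : ℕ) {A Γ Ex Ey Sx Sy : ℕ} (hvx : degX v ≤ A)
    (hux : degX u' ≤ A) (hvy : v.natDegree ≤ Γ) (huy : (X * u').natDegree ≤ Γ)
    (hx : Sx ≠ 0 → Sx + A ≤ Ex) (hy : Sy + Γ ≤ Ey + 1) {s : K[X][Y]}
    (hs : ∀ i, Sy ≤ i → s.coeff i = 0) (hs' : ∀ i, (s.coeff i).degree < Sx) :
    (Bivariate.swap (certOp v u' r s)).degree < Ex ∧ (certOp v u' r s).degree < Ey := by
  rcases eq_or_ne s 0 with rfl | h0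
  · simp only [map_zero, degree_zero]
    exact ⟨WithBot.bot_lt_coe _, WithBot.bot_lt_coe _⟩
  constructor
  · have hlt := degX_lt_of_degree_coeff_lt hs' h0
    have hx' := hx (by omega)
    have h1 : (Bivariate.swap (certOp v u' r s)).natDegree ≤ A + degX s := by
      rw [certOp_apply]
      simp only [map_add, map_mul, map_sub, map_natCast, map_one]
      refine (natDegree_add_le_of_le (natDegree_mul_le_of_le hvx (degX_derivative_le s))
        (natDegree_mul_le_of_le (m := A) ?_ le_rfl)).trans (max_self _).le
      refine (natDegree_sub_le_of_le hux (n := A) ?_).trans (max_self _).le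
      rw [show ((r : K[X][Y]) - 1) = C ((r : K[X]) - 1) by simp]
      exact (natDegree_C_mul_le _ _).trans ((degX_derivative_le v).trans hvx)
    refine degree_le_natDegree.trans_lt ?_
    exact_mod_cast (by omega : (Bivariate.swap (certOp v u' r s)).natDegree < Ex)
  · have hlt : s.natDegree < Sy := by
      by_contra hcon
      exact h0 (leadingCoeff_eq_zero.1 (hs _ (not_lt.1 hcon)))
    have h1 : (X * certOp v u' r s).natDegree ≤ Γ + s.natDegree := by
      have : X * certOp v u' r s = (X * derivative s - C 0 * s) * v
          + s * (X * u' - C ((r : K[X]) - 1) * (X * derivative v)) := by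
        rw [certOp_apply]
        simp only [map_sub, map_natCast, map_one, map_zero]
        ring
      rw [this, add_comm Γ]
      exact (natDegree_step _ _ le_rfl hvy huy).1
    rw [degree_lt_iff_coeff_zero]
    intro k hk
    rw [← coeff_X_mul]
    exact coeff_eq_zero_of_natDegree_lt (by omega)

theorem natDegree_numer_le {c v u : K[X][Y]} {Γ : ℕ} (hv : v.natDegree ≤ Γ) (hu : u.natDegree ≤ Γ)
    (i : ℕ) : (numer c v u i).natDegree ≤ c.natDegree + i * Γ := by
  induction i with
  | zero => simp [numer]
  | succ i ih =>
    rw [numer, Nat.succ_mul, ← add_assoc]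
    refine (natDegree_add_le_of_le
      (natDegree_mul_le_of_le ((natDegree_dX_le _).trans ih) hv)
      (natDegree_mul_le_of_le (n := Γ) ih ?_)).trans (max_self _).le
    refine (natDegree_sub_le_of_le hu (n := Γ) ?_).trans (max_self _).le
    rw [show (i : K[X][Y]) = C (i : K[X]) by simp]
    exact (natDegree_C_mul_le _ _).trans ((natDegree_dX_le v).trans hv)

theorem telNum_degree_lt {c v u : K[X][Y]} {Γ : ℕ} (hv : v.natDegree ≤ Γ) (hu : u.natDegree ≤ Γ)
    (r : ℕ) (p : K[X][Y]) :
    (telNum c v u r p).degree < ((c.natDegree + r * Γ + 1 : ℕ) : WithBot ℕ) := by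
  refine degree_le_natDegree.trans_lt ?_
  suffices (telNum c v u r p).natDegree ≤ c.natDegree + r * Γ by
    exact_mod_cast Nat.lt_succ_of_le this
  rw [telNum_apply]
  refine natDegree_sum_le_of_forall_le _ _ fun i hi => (natDegree_C_mul_le _ _).trans ?_
  refine (natDegree_mul_le_of_le (natDegree_numer_le hv hu i)
    (natDegree_pow_le_of_le (r - i) hv)).trans (le_of_eq ?_)
  have : i + (r - i) = r := by
    have := Finset.mem_range.1 hi
    omega
  rw [add_assoc, ← add_mul, this]

theorem swap_telNum (c v u : K[X][Y]) (r : ℕ) (p : K[X][Y]) :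
    Bivariate.swap (telNum c v u r p) = ∑ i ∈ Finset.range (r + 1),
      (p.coeff i).map C * (Bivariate.swap (numer c v u i) * Bivariate.swap v ^ (r - i)) := by
  rw [telNum_apply, map_sum]
  simp [Bivariate.swap_C]

/-- Degree and top coefficient of `∑ pᵢ Gᵢ` where `deg pᵢ < mᵢ`. -/
theorem natDegree_sum_map_mul_le {r : ℕ} {G : ℕ → K[X][Y]} {γ m : ℕ → ℕ} {n : ℕ}
    (hG : ∀ i ≤ r, (G i).natDegree ≤ γ i) (hm : ∀ i ≤ r, m i ≠ 0 → m i + γ i ≤ n + 1)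
    {p : K[X][Y]} (hp : ∀ i, (p.coeff i).degree < m i) :
    (∑ i ∈ Finset.range (r + 1), (p.coeff i).map C * G i).natDegree ≤ n ∧
    (∑ i ∈ Finset.range (r + 1), (p.coeff i).map C * G i).coeff n =
      ∑ i ∈ Finset.range (r + 1), C ((p.coeff i).coeff (n - γ i)) * (G i).coeff (γ i) := by
  have key : ∀ i ∈ Finset.range (r + 1), ((p.coeff i).map C * G i).natDegree ≤ n ∧
      ((p.coeff i).map C * G i).coeff n =
        C ((p.coeff i).coeff (n - γ i)) * (G i).coeff (γ i) := by
    intro i hi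
    have hir : i ≤ r := Nat.lt_succ_iff.1 (Finset.mem_range.1 hi)
    rcases eq_or_ne (p.coeff i) 0 with h0 | h0
    · simp [h0]
    have hlt := (natDegree_lt_iff_degree_lt h0).2 (hp i)
    have hle := hm i hir (by omega)
    have h1 : ((p.coeff i).map (C : K →+* K[X])).natDegree ≤ n - γ i :=
      natDegree_map_le.trans (by omega)
    have h2 : n - γ i + γ i = n := by omega
    constructor
    · exact (natDegree_mul_le_of_le h1 (hG i hir)).trans h2.le
    · conv_lhs => rw [← h2]
      rw [coeff_mul_add_eq_of_natDegree_le h1 (hG i hir), coeff_map]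
  refine ⟨natDegree_sum_le_of_forall_le _ _ fun i hi => (key i hi).1, ?_⟩
  rw [finsetSum_coeff]
  exact Finset.sum_congr rfl fun i hi => (key i hi).2

theorem degX_numer_le {c v u : K[X][Y]} {α : ℕ} (hv : degX v ≤ α) (hu : degX u ≤ α)
    (i : ℕ) : degX (numer c v u i) ≤ degX c + i * α := by
  induction i with
  | zero => simp [numer]
  | succ i ih =>
    rw [numer, Nat.succ_mul, ← add_assoc, degX]
    simp only [map_add, map_mul, map_sub, map_natCast, swap_dX]
    refine (natDegree_add_le_of_le
      (natDegree_mul_le_of_le ((natDegree_derivative_le _).trans ((Nat.sub_le _ _).trans ih)) hv)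
      (natDegree_mul_le_of_le (n := α) ih ?_)).trans (max_self _).le
    refine (natDegree_sub_le_of_le hu (n := α) ?_).trans (max_self _).le
    rw [show (i : K[X][Y]) = C (i : K[X]) by simp]
    exact (natDegree_C_mul_le _ _).trans
      ((natDegree_derivative_le _).trans ((Nat.sub_le _ _).trans hv))

/-- Each differentiation contributes α + β to the x-degree while each remaining factor v contributes
only α; the i-th term therefore exceeds the 0-th bound by iβ. -/
theorem swap_telNum_degree_lt {c v u : K[X][Y]} {α β : ℕ} (hv : degX v ≤ α)
    (hu : degX u ≤ α + β) {r Ex : ℕ} {m : ℕ → ℕ}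
    (hm : ∀ i ≤ r, m i ≠ 0 → m i + (degX c + r * α + i * β) ≤ Ex)
    {p : K[X][Y]} (hp : ∀ i, (p.coeff i).degree < m i) :
    (Bivariate.swap (telNum c v u r p)).degree < Ex := by
  have hG : ∀ i ≤ r, (Bivariate.swap (numer c v u i) * Bivariate.swap v ^ (r - i)).natDegree ≤
      degX c + r * α + i * β := by
    intro i hi
    refine (natDegree_mul_le_of_le (degX_numer_le (hv.trans (Nat.le_add_right α β)) hu i)
      (natDegree_pow_le_of_le (r - i) hv)).trans (le_of_eq ?_)
    obtain ⟨k, rfl⟩ := Nat.exists_eq_add_of_le hi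
    rw [Nat.add_sub_cancel_left]
    ring
  rw [swap_telNum]
  rcases Ex with _ | n
  · have : ∀ i ∈ Finset.range (r + 1), (p.coeff i).map C *
        (Bivariate.swap (numer c v u i) * Bivariate.swap v ^ (r - i)) = 0 := by
      intro i hi
      have hmi : m i = 0 := by
        by_contra h
        have := hm i (Nat.lt_succ_iff.1 (Finset.mem_range.1 hi)) h
        omega
      have := hp i
      rw [hmi, Nat.cast_zero, Nat.WithBot.lt_zero_iff, degree_eq_bot] at this
      simp [this]
    rw [Finset.sum_eq_zero this, degree_zero]
    exact WithBot.bot_lt_coe _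
  · refine degree_le_natDegree.trans_lt ?_
    exact_mod_cast Nat.lt_succ_of_le (natDegree_sum_map_mul_le hG hm hp).1

/-- Degree and top coefficient of the numerators when `D_x g / g` vanishes at infinity with leading
coefficient `w`. -/
theorem numer_top {c v u : K[X][Y]} {α : ℕ} {w : K} (hv : degX v ≤ α + 1)
    (hu : (X * Bivariate.swap u).natDegree ≤ α + 1)
    (hw : (X * Bivariate.swap u).coeff (α + 1) = C w * (Bivariate.swap v).coeff (α + 1)) (i : ℕ) :
    degX (numer c v u i) ≤ degX c + i * α ∧
      (Bivariate.swap (numer c v u i)).coeff (degX c + i * α) =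
        C (∏ j ∈ Finset.range i, ((degX c : K) + w - j)) *
          (lcX c * (Bivariate.swap v).coeff (α + 1) ^ i) := by
  induction i with
  | zero =>
    constructor
    · simp [numer]
    · simp [numer, lcX, degX]
  | succ i ih =>
    have hstep := natDegree_step (i : K[X]) 0 ih.1 hv hu
    have e : X * Bivariate.swap (numer c v u (i + 1)) =
        (X * derivative (Bivariate.swap (numer c v u i)) - C 0 * Bivariate.swap (numer c v u i))
          * Bivariate.swap v + Bivariate.swap (numer c v u i) *
          (X * Bivariate.swap u - C (i : K[X]) * (X * derivative (Bivariate.swap v))) := by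
      rw [numer]
      simp only [map_add, map_mul, map_sub, map_natCast, swap_dX, map_zero]
      ring
    rw [← e] at hstep
    have hn : degX c + i * α + (α + 1) = degX c + (i + 1) * α + 1 := by ring
    rw [hn] at hstep
    refine ⟨natDegree_le_of_natDegree_X_mul_le hstep.1, ?_⟩
    rw [← coeff_X_mul, hstep.2, ih.2, hw, Finset.prod_range_succ]
    simp only [map_mul, map_sub, map_add, map_natCast, Nat.cast_add, Nat.cast_mul, Nat.cast_one]
    ring

/-- Numerators of `∏_{k < j} (x D_x - n + k) (c * g)`. -/
def eulerNumer (c v u : K[X][Y]) (n : ℕ) : ℕ → K[X][Y]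
  | 0 => c
  | j + 1 => C X * (dX (eulerNumer c v u n j) * v
      + eulerNumer c v u n j * (u - (j : K[X][Y]) * dX v))
      - ((n : K[X][Y]) - (j : K[X][Y])) * v * eulerNumer c v u n j

/-- After j factors the term behaves at worst like x^(n-j) at infinity, and x D_x - (n - j)
annihilates exactly this power. Each factor brings in v, of degree at most α + 1, and cancels one
leading term, for a net gain of α. -/
theorem degX_eulerNumer_le {c v u : K[X][Y]} {α n : ℕ} {w : K} (hv : degX v ≤ α + 1)
    (hu : (X * Bivariate.swap u).natDegree ≤ α + 1)
    (hw : (X * Bivariate.swap u).coeff (α + 1) = C w * (Bivariate.swap v).coeff (α + 1))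
    (hn : (degX c : K) + w = n) (j : ℕ) :
    degX (eulerNumer c v u n j) ≤ degX c + j * α := by
  induction j with
  | zero => simp [eulerNumer]
  | succ j ih =>
    have hstep := natDegree_step (j : K[X]) ((n : K[X]) - j) ih hv hu
    have e : Bivariate.swap (eulerNumer c v u n (j + 1)) =
        (X * derivative (Bivariate.swap (eulerNumer c v u n j))
          - C ((n : K[X]) - j) * Bivariate.swap (eulerNumer c v u n j))
          * Bivariate.swap v + Bivariate.swap (eulerNumer c v u n j) *
          (X * Bivariate.swap u - C (j : K[X]) * (X * derivative (Bivariate.swap v))) := by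
      rw [eulerNumer]
      simp only [map_add, map_mul, map_sub, map_natCast, swap_dX, Bivariate.swap_X]
      ring
    rw [← e, hw] at hstep
    have h0 : (Bivariate.swap (eulerNumer c v u n (j + 1))).coeff (degX c + j * α + (α + 1)) = 0 := by
      rw [hstep.2]
      have hw' : (C w : K[X]) = n - degX c := by
        rw [← map_natCast C n, ← map_natCast C (degX c), ← map_sub, ← hn, add_sub_cancel_left]
      rw [hw']
      push_cast
      ring
    have hlt := degree_lt_of_natDegree_le_of_coeff_eq_zero hstep.1 h0
    rw [degX, natDegree_le_iff_coeff_eq_zero]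
    rw [degree_lt_iff_coeff_zero] at hlt
    have hm : degX c + j * α + (α + 1) = degX c + (j + 1) * α + 1 := by ring
    exact fun k hk => hlt k (by omega)

end Bounds

/-! ### The Euler operator and the degree drop for natural ω. -/

section Euler

variable {K E : Type*} [Field K] [Field E] [Algebra (RatXY K) E]

/-- The Euler operator `x D_x`. -/
def eulerOp (D : DiffExt K E) : Module.End ℤ E :=
  LinearMap.mulLeft ℤ (embHom E (C X : K[X][Y])) ∘ₗ D.Dx.toLinearMap

theorem eulerOp_apply (D : DiffExt K E) (f : E) :
    eulerOp D f = embHom E (C X : K[X][Y]) * D.Dx f := rfl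

theorem aeval_eulerOp_mul (D : DiffExt K E) (p : ℤ[X]) (k : ℤ) (f : E) :
    aeval (eulerOp D) ((X - C k) * p) f =
      embHom E (C X : K[X][Y]) * D.Dx (aeval (eulerOp D) p f) - k * aeval (eulerOp D) p f := by
  rw [map_mul, Module.End.mul_apply, map_sub, aeval_X, aeval_C, LinearMap.sub_apply, eulerOp_apply]
  simp

/-- This is x^k D_x^k = θ(θ-1)⋯(θ-k+1) with θ = x D_x. Evaluating a polynomial at θ makes the
factors commute for free. -/
theorem aeval_eulerOp_prod (D : DiffExt K E) (f : E) (k : ℕ) :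
    aeval (eulerOp D) (∏ j ∈ Finset.range k, (X - C (j : ℤ))) f =
      embHom E (C X : K[X][Y]) ^ k * (D.Dx)^[k] f := by
  induction k with
  | zero => simp
  | succ k ih =>
    rw [Finset.prod_range_succ, mul_comm, aeval_eulerOp_mul, ih, D.Dx.leibniz, D.Dx.leibniz_pow,
      D.Dx_embHom, dX_C, derivative_X, C_1, map_one, Function.iterate_succ_apply']
    rcases k with _ | k
    · simp
    · simp only [smul_eq_mul, nsmul_eq_mul, Nat.add_sub_cancel]
      push_cast
      ring

theorem aeval_eulerOp_term {D : DiffExt K E} {g : E} {v u : K[X][Y]} (hv : v ≠ 0)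
    (hx : D.Dx g = embHom E u / embHom E v * g) (c : K[X][Y]) (n k : ℕ) :
    aeval (eulerOp D) (∏ j ∈ Finset.range k, (X - C ((n : ℤ) - j))) (embHom E c * g) =
      embHom E (eulerNumer c v u n k) / embHom E v ^ k * g := by
  have hv' := embHom_ne_zero (E := E) hv
  induction k with
  | zero => simp [eulerNumer]
  | succ k ih =>
    rw [Finset.prod_range_succ, mul_comm, aeval_eulerOp_mul, ih, Dx_div_pow_mul hv hx, eulerNumer]
    simp only [map_add, map_mul, map_sub, map_natCast, Int.cast_sub, Int.cast_natCast]
    field_simp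
    ring

/-- The factors θ - n, …, θ - 0 taken in reverse order form x^(n+1) D_x^(n+1). Hence the
cancellations found for `eulerNumer` pass to `numer`. -/
theorem eulerNumer_eq {D : DiffExt K E} {g : E} (hg : g ≠ 0) {v u : K[X][Y]} (hv : v ≠ 0)
    (hx : D.Dx g = embHom E u / embHom E v * g) (c : K[X][Y]) (n : ℕ) :
    eulerNumer c v u n (n + 1) = C X ^ (n + 1) * numer c v u (n + 1) := by
  have hv' := embHom_ne_zero (E := E) hv
  have h := aeval_eulerOp_term hv hx c n (n + 1)
  have hrefl : ∏ j ∈ Finset.range (n + 1), (X - C ((n : ℤ) - j)) =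
      ∏ j ∈ Finset.range (n + 1), (X - C (j : ℤ)) := by
    rw [← Finset.prod_range_reflect (fun j => X - C ((j : ℕ) : ℤ)) (n + 1)]
    refine Finset.prod_congr rfl fun j hj => ?_
    have : j ≤ n := Nat.lt_succ_iff.1 (Finset.mem_range.1 hj)
    rw [Nat.add_sub_cancel, Nat.cast_sub this]
  rw [hrefl, aeval_eulerOp_prod, iterate_Dx hv hx] at h
  apply embHom_injective (E := E)
  rw [map_mul, map_pow]
  field_simp at h
  exact h.symm

/-- If `c * g` behaves like `x ^ n` at infinity, the numerators `Nᵢ` with `i > n` drop in degree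
by `n + 1`. -/
theorem numer_top_of_nat {D : DiffExt K E} {g : E} (hg : g ≠ 0) {c v u : K[X][Y]} (hv0 : v ≠ 0)
    (hx : D.Dx g = embHom E u / embHom E v * g) {α n : ℕ} {w : K} (hv : degX v ≤ α + 1)
    (hu : (X * Bivariate.swap u).natDegree ≤ α + 1)
    (hw : (X * Bivariate.swap u).coeff (α + 1) = C w * (Bivariate.swap v).coeff (α + 1))
    (hn : (degX c : K) + w = n) :
    ∃ ℓ : K[X], ∀ k : ℕ,
      (X ^ (n + 1) * Bivariate.swap (numer c v u (n + 1 + k))).natDegree ≤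
          degX c + (n + 1 + k) * α ∧
      (X ^ (n + 1) * Bivariate.swap (numer c v u (n + 1 + k))).coeff
          (degX c + (n + 1 + k) * α) =
        C (∏ j ∈ Finset.range k, (-((n : K) + 2 + j))) *
          (ℓ * (Bivariate.swap v).coeff (α + 1) ^ k) := by
  -- Once x^n, …, x^0 have been differentiated away, the leading power is at worst x^(-n-2), coming
  -- from x^(-1); further derivatives contribute the factors -(n+2), -(n+3), …, and ℓ is the initial
  -- top coefficient.
  refine ⟨(X ^ (n + 1) * Bivariate.swap (numer c v u (n + 1))).coeff (degX c + (n + 1) * α),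
    fun k => ?_⟩
  induction k with
  | zero =>
    constructor
    · have := degX_eulerNumer_le hv hu hw hn (n + 1)
      rw [eulerNumer_eq hg hv0 hx, degX, map_mul, map_pow, Bivariate.swap_X] at this
      exact this
    · simp
  | succ k ih =>
    set L := X ^ (n + 1) * Bivariate.swap (numer c v u (n + 1 + k)) with hL
    have hstep := natDegree_step ((n + 1 + k : ℕ) : K[X]) ((n + 1 : ℕ) : K[X]) ih.1 hv hu
    have e : X * (X ^ (n + 1) * Bivariate.swap (numer c v u (n + 1 + (k + 1)))) =
        (X * derivative L - C ((n + 1 : ℕ) : K[X]) * L)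
          * Bivariate.swap v + L *
          (X * Bivariate.swap u
            - C ((n + 1 + k : ℕ) : K[X]) * (X * derivative (Bivariate.swap v))) := by
      rw [hL, ← add_assoc, numer, derivative_mul, derivative_X_pow]
      simp only [map_add, map_mul, map_sub, map_natCast, swap_dX, Nat.add_sub_cancel]
      ring
    rw [← e, hw] at hstep
    have hm : degX c + (n + 1 + k) * α + (α + 1) = degX c + (n + 1 + (k + 1)) * α + 1 := by ring
    rw [hm] at hstep
    refine ⟨natDegree_le_of_natDegree_X_mul_le hstep.1, ?_⟩
    rw [← coeff_X_mul, hstep.2, ih.2, Finset.prod_range_succ]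
    have hw' : (C w : K[X]) = n - degX c := by
      rw [← map_natCast C n, ← map_natCast C (degX c), ← map_sub, ← hn, add_sub_cancel_left]
    rw [hw']
    simp only [map_mul, map_neg, map_add, map_natCast, map_ofNat]
    push_cast
    ring

end Euler

/-! ### Sums of truncated differences. -/

section Counting

theorem sum_range_sub_mul_two (t k : ℕ) :
    (∑ i ∈ Finset.range (t + k + 1), (i - t)) * 2 = k * (k + 1) := by
  induction k with
  | zero =>
    have : ∑ i ∈ Finset.range (t + 1), (i - t) = 0 :=
      Finset.sum_eq_zero fun i hi => by
        have := Finset.mem_range.1 hi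
        omega
    rw [add_zero, this, zero_mul, zero_mul]
  | succ k ih =>
    rw [← add_assoc, Finset.sum_range_succ, add_mul, ih, add_assoc, Nat.add_sub_cancel_left]
    ring

theorem sum_range_const_sub_mul_two (k t : ℕ) :
    (∑ i ∈ Finset.range (k + t + 1), (k - i)) * 2 = k * (k + 1) := by
  induction t with
  | zero =>
    have := Finset.sum_range_reflect (fun i => i) (k + 1)
    simp only [Nat.add_sub_cancel] at this
    rw [add_zero, this, Finset.sum_range_id_mul_two, Nat.add_sub_cancel, mul_comm]
  | succ t ih =>
    rw [← add_assoc, Finset.sum_range_succ, add_mul, ih]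
    simp
    omega

end Counting

/-! ### Comparing unknowns and equations in the three regimes. -/

section CountingRelations

variable {K E : Type*} [Field K] [Field E] [Algebra (RatXY K) E]

/-- There are at least `n - φ` exponents below `n` such that no nonzero polynomial with these
`y`-exponents only is a solution of `certOp v u' r s = 0`. -/
def HasFreeExponents (v u' : K[X][Y]) (r n φ : ℕ) : Prop :=
  ∃ J ⊆ Finset.range n, n ≤ J.card + φ ∧
    ∀ s : K[X][Y], (∀ i ∉ J, s.coeff i = 0) → certOp v u' r s = 0 → s = 0

/-- There are Ex (Sy + Γ - 1) + k equations, and s supplies at least (Ex - A)(Sy - φ) unknowns; the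
pᵢ must exceed the difference Ex (Γ + φ - 1) + A (Sy - φ) + k. Since Ex is multiplied by Γ + φ - 1,
a lost exponent is offset there when Γ decreases by one. -/
theorem hasRelation_of_bounds {D : DiffExt K E} {g : E} (hg : g ≠ 0) {v u u' : K[X][Y]}
    (hv : v ≠ 0) (hx : D.Dx g = embHom E u / embHom E v * g)
    (hy : D.Dy g = embHom E u' / embHom E v * g) (c : K[X][Y]) {A Γ Sy φ r d : ℕ}
    (hvx : degX v ≤ A) (hux' : degX u' ≤ A)
    (hvy : v.natDegree ≤ Γ) (huy : u.natDegree ≤ Γ) (huy' : (X * u').natDegree ≤ Γ)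
    (hSy : Sy + Γ = c.natDegree + r * Γ + 2) (hφ : φ ≤ Sy) (hfree : HasFreeExponents v u' r Sy φ)
    (m : ℕ → ℕ) (hm : ∀ i, m i ≤ d + 1) {k : ℕ} (Λ : Fin k → K[X][Y] →ₗ[K] K) (Ex : ℕ)
    (htel : ∀ p : K[X][Y], (∀ i, (p.coeff i).degree < m i) → (∀ j, Λ j p = 0) →
      (Bivariate.swap (telNum c v u r p)).degree < Ex)
    (hcount : (Ex : ℤ) * (Γ + φ - 1) + A * (Sy - φ) + k <
      ∑ i ∈ Finset.range (r + 1), (m i : ℤ)) :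
    HasRelation D (embHom E c * g) r d := by
  obtain ⟨J, hJ, hcard, hinj⟩ := hfree
  refine hasRelation_of_count hg hv hx hy c m hm Λ Ex (c.natDegree + r * Γ + 1) (Ex - A) J
    (fun p hp hΛ => ⟨htel p hp hΛ, telNum_degree_lt hvy huy r p⟩)
    (fun s hs hs' => certOp_degree_lt r hvx hux' hvy huy' (Sy := Sy) (by omega) (by omega)
      (fun i hi => hs i fun hiJ => ?_) hs')
    (fun s hs _ h0 => hinj s hs h0) ?_
  · have := Finset.mem_range.1 (hJ hiJ)
    omega
  · zify
    have hE : (c.natDegree : ℤ) + r * Γ + 1 = Sy + Γ - 1 := by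
      have : (Sy : ℤ) + Γ = c.natDegree + r * Γ + 2 := by exact_mod_cast hSy
      linarith
    rw [hE]
    have h1 : (Ex : ℤ) - A ≤ ((Ex - A : ℕ) : ℤ) := by omega
    have h2 : (Sy : ℤ) - φ ≤ J.card := by omega
    have h3 : (0 : ℤ) ≤ (Sy : ℤ) - φ := by omega
    have h4 : ((Ex : ℤ) - A) * (Sy - φ) ≤ ((Ex - A : ℕ) : ℤ) * J.card :=
      (mul_le_mul_of_nonneg_right h1 h3).trans (mul_le_mul_of_nonneg_left h2 (by positivity))
    linarith

/-- Counting when `D_x g / g` has degree at most `β`. -/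
theorem hasRelation_of_degX_le {D : DiffExt K E} {g : E} (hg : g ≠ 0) {v u u' : K[X][Y]}
    (hv : v ≠ 0) (hx : D.Dx g = embHom E u / embHom E v * g)
    (hy : D.Dy g = embHom E u' / embHom E v * g) (c : K[X][Y]) {α β A Γ Sy φ r d : ℕ}
    (hvx : degX v ≤ α) (hαA : α ≤ A) (hux : degX u ≤ α + β) (hux' : degX u' ≤ A)
    (hvy : v.natDegree ≤ Γ) (huy : u.natDegree ≤ Γ) (huy' : (X * u').natDegree ≤ Γ)
    (hSy : Sy + Γ = c.natDegree + r * Γ + 2) (hφ : φ ≤ Sy) (hfree : HasFreeExponents v u' r Sy φ)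
    (k : ℕ) (hk : k ≤ r)
    (hcount : 2 * (((d : ℤ) + degX c + r * α + (r - k) * β + 1) * (Γ + φ - 1) + A * (Sy - φ))
      + β * (k * (k + 1)) < 2 * ((r + 1) * (d + 1))) :
    HasRelation D (embHom E c * g) r d := by
  obtain ⟨t, rfl⟩ := Nat.exists_eq_add_of_le' hk
  -- Here t = r - k. Shortening pᵢ by β(i - t) for i > t keeps all terms within the x-degree bound
  -- of the term i = t. This lowers Ex by kβ at the cost of at most βk(k+1)/2 unknowns.
  refine hasRelation_of_bounds hg hv hx hy c (hvx.trans hαA) hux' hvy huy huy' hSy hφ hfree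
    (fun i => d + 1 - β * (i - t)) (fun i => Nat.sub_le _ _) (k := 0) Fin.elim0
    (d + degX c + (t + k) * α + t * β + 1)
    (fun p hp _ => swap_telNum_degree_lt hvx hux ?_ hp) ?_
  · intro i hi hmi
    rcases le_total i t with h | h
    · have := Nat.mul_le_mul_right β h
      omega
    · obtain ⟨j, rfl⟩ := Nat.exists_eq_add_of_le h
      rw [Nat.add_sub_cancel_left] at hmi ⊢
      rw [add_mul t j, mul_comm j β]
      omega
  · have hsum : (∑ i ∈ Finset.range (t + k + 1), ((d : ℤ) + 1 - β * ((i - t : ℕ) : ℤ))) ≤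
        ∑ i ∈ Finset.range (t + k + 1), ((d + 1 - β * (i - t) : ℕ) : ℤ) :=
      Finset.sum_le_sum fun i _ => by
        rw [← Nat.cast_mul]
        omega
    rw [Finset.sum_sub_distrib, ← Finset.mul_sum, Finset.sum_const, Finset.card_range,
      nsmul_eq_mul] at hsum
    have h2 : (∑ i ∈ Finset.range (t + k + 1), ((i - t : ℕ) : ℤ)) * 2 = k * (k + 1) := by
      exact_mod_cast sum_range_sub_mul_two t k
    have h3 : (β : ℤ) * (∑ i ∈ Finset.range (t + k + 1), ((i - t : ℕ) : ℤ)) * 2 =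
        β * (k * (k + 1)) := by rw [mul_assoc, h2]
    push_cast at hcount hsum ⊢
    linarith

/-- The linear functional `p ↦ ∑ κᵢ [x ^ eᵢ] pᵢ`. -/
def coeffFunctional (I : Finset ℕ) (κ : ℕ → K) (e : ℕ → ℕ) : K[X][Y] →ₗ[K] K :=
  ∑ i ∈ I, κ i • (lcoeff K (e i) ∘ₗ (lcoeff K[X] i).restrictScalars K)

theorem coeffFunctional_apply (I : Finset ℕ) (κ : ℕ → K) (e : ℕ → ℕ) (p : K[X][Y]) :
    coeffFunctional I κ e p = ∑ i ∈ I, κ i * (p.coeff i).coeff (e i) := by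
  simp [coeffFunctional, LinearMap.sum_apply]

/-- The coefficient of x^n in every term is a scalar times the same polynomial lc_x(c) V^r in y,
where V is the top coefficient of v. One scalar condition therefore makes the sum of these
coefficients vanish for all powers of y at once. -/
theorem swap_telNum_degree_lt_of_top {c v u : K[X][Y]} {α : ℕ} {w : K} (hv : degX v ≤ α + 1)
    (hu : (X * Bivariate.swap u).natDegree ≤ α + 1)
    (hw : (X * Bivariate.swap u).coeff (α + 1) = C w * (Bivariate.swap v).coeff (α + 1))
    {r n : ℕ} {m : ℕ → ℕ}
    (hm : ∀ i ≤ r, m i ≠ 0 → m i + (degX c + i * α + (r - i) * (α + 1)) ≤ n + 1)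
    {p : K[X][Y]} (hp : ∀ i, (p.coeff i).degree < m i)
    (hΛ : coeffFunctional (Finset.range (r + 1))
      (fun i => ∏ j ∈ Finset.range i, ((degX c : K) + w - j))
      (fun i => n - (degX c + i * α + (r - i) * (α + 1))) p = 0) :
    (Bivariate.swap (telNum c v u r p)).degree < n := by
  have hG : ∀ i ≤ r, (Bivariate.swap (numer c v u i) * Bivariate.swap v ^ (r - i)).natDegree ≤
      degX c + i * α + (r - i) * (α + 1) := fun i _ =>
    natDegree_mul_le_of_le (numer_top hv hu hw i).1 (natDegree_pow_le_of_le (r - i) hv)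
  obtain ⟨h1, h2⟩ := natDegree_sum_map_mul_le hG hm hp
  rw [swap_telNum]
  refine degree_lt_of_natDegree_le_of_coeff_eq_zero h1 ?_
  rw [h2]
  have hterm : ∀ i ∈ Finset.range (r + 1),
      C ((p.coeff i).coeff (n - (degX c + i * α + (r - i) * (α + 1)))) *
        (Bivariate.swap (numer c v u i) * Bivariate.swap v ^ (r - i)).coeff
          (degX c + i * α + (r - i) * (α + 1)) =
      C ((∏ j ∈ Finset.range i, ((degX c : K) + w - j)) *
        (p.coeff i).coeff (n - (degX c + i * α + (r - i) * (α + 1)))) *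
        (lcX c * (Bivariate.swap v).coeff (α + 1) ^ r) := by
    intro i hi
    have hir : i + (r - i) = r := by
      have := Finset.mem_range.1 hi
      omega
    rw [coeff_mul_add_eq_of_natDegree_le (numer_top hv hu hw i).1
      (natDegree_pow_le_of_le (r - i) hv), (numer_top hv hu hw i).2,
      coeff_pow_of_natDegree_le hv, C_mul]
    conv_rhs => rw [← hir, pow_add, hir]
    ring
  rw [Finset.sum_congr rfl hterm, ← Finset.sum_mul, ← map_sum, ← coeffFunctional_apply, hΛ,
    map_zero, zero_mul]

/-- Counting when `D_x g / g` vanishes at infinity. -/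
theorem hasRelation_of_top {D : DiffExt K E} {g : E} (hg : g ≠ 0) {v u u' : K[X][Y]}
    (hv : v ≠ 0) (hx : D.Dx g = embHom E u / embHom E v * g)
    (hy : D.Dy g = embHom E u' / embHom E v * g) (c : K[X][Y]) {α Γ Sy φ r d : ℕ} {w : K}
    (hvx : degX v ≤ α + 1) (hux : (X * Bivariate.swap u).natDegree ≤ α + 1)
    (hw : (X * Bivariate.swap u).coeff (α + 1) = C w * (Bivariate.swap v).coeff (α + 1))
    (hux' : degX u' ≤ α + 1)
    (hvy : v.natDegree ≤ Γ) (huy : u.natDegree ≤ Γ) (huy' : (X * u').natDegree ≤ Γ)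
    (hSy : Sy + Γ = c.natDegree + r * Γ + 2) (hφ : φ ≤ Sy) (hfree : HasFreeExponents v u' r Sy φ)
    (k : ℕ) (hk : k ≤ r)
    (hcount : 2 * (((d : ℤ) + degX c + r * (α + 1) - k) * (Γ + φ - 1)
      + (α + 1) * (Sy - φ) + 1) + k * (k + 1) < 2 * ((r + 1) * (d + 1))) :
    HasRelation D (embHom E c * g) r d := by
  have hγ : ∀ i ≤ r, degX c + i * α + (r - i) * (α + 1) + i = degX c + r * (α + 1) := by
    intro i hi
    obtain ⟨j, rfl⟩ := Nat.exists_eq_add_of_le hi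
    rw [Nat.add_sub_cancel_left]
    ring
  have hkr : k ≤ r * (α + 1) := hk.trans (Nat.le_mul_of_pos_right r (Nat.succ_pos α))
  -- The degree bound falls by one per derivative, so the pᵢ with i < k are the ones to shorten, by
  -- k - i. This lowers Ex by k for at most k(k+1)/2 unknowns, and the functional removes one more
  -- column.
  refine hasRelation_of_bounds hg hv hx hy c hvx hux' hvy huy huy' hSy hφ hfree
    (fun i => d + 1 - (k - i)) (fun i => Nat.sub_le _ _) (k := 1)
    (fun _ => coeffFunctional (Finset.range (r + 1))
      (fun i => ∏ j ∈ Finset.range i, ((degX c : K) + w - j))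
      (fun i => d + degX c + r * (α + 1) - k - (degX c + i * α + (r - i) * (α + 1))))
    (d + degX c + r * (α + 1) - k)
    (fun p hp hΛ => swap_telNum_degree_lt_of_top hvx hux hw ?_ hp (hΛ 0)) ?_
  · intro i hi hmi
    have := hγ i hi
    omega
  · have hsum : (∑ i ∈ Finset.range (r + 1), ((d : ℤ) + 1 - ((k - i : ℕ) : ℤ))) ≤
        ∑ i ∈ Finset.range (r + 1), ((d + 1 - (k - i) : ℕ) : ℤ) :=
      Finset.sum_le_sum fun i _ => by omega
    rw [Finset.sum_sub_distrib, Finset.sum_const, Finset.card_range, nsmul_eq_mul] at hsum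
    have h2 : (∑ i ∈ Finset.range (r + 1), ((k - i : ℕ) : ℤ)) * 2 = k * (k + 1) := by
      obtain ⟨t, rfl⟩ := Nat.exists_eq_add_of_le hk
      exact_mod_cast sum_range_const_sub_mul_two k t
    have h3 : ((d + degX c + r * (α + 1) - k : ℕ) : ℤ) = (d : ℤ) + degX c + r * (α + 1) - k := by
      rw [Nat.cast_sub (by omega)]
      push_cast
      ring
    rw [h3]
    push_cast at hsum ⊢
    linarith

theorem swap_telNum_degree_lt_of_nat {D : DiffExt K E} {g : E} (hg : g ≠ 0) {c v u : K[X][Y]}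
    (hv0 : v ≠ 0) (hx : D.Dx g = embHom E u / embHom E v * g) {α n : ℕ} {w : K}
    (hv : degX v ≤ α + 1) (hu : (X * Bivariate.swap u).natDegree ≤ α + 1)
    (hw : (X * Bivariate.swap u).coeff (α + 1) = C w * (Bivariate.swap v).coeff (α + 1))
    (hn : (degX c : K) + w = n) {r N : ℕ} (hnr : n < r) {m γ : ℕ → ℕ}
    (hγ : ∀ i, γ i = degX c + i * α + (r - i) * (α + 1) + if i < n + 1 then n + 1 else 0)
    (hm : ∀ i ≤ r, m i ≠ 0 → m i + γ i ≤ N + (n + 1) + 1)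
    {p : K[X][Y]} (hp : ∀ i, (p.coeff i).degree < m i)
    (hΛ : coeffFunctional (Finset.range (n + 1))
      (fun i => ∏ j ∈ Finset.range i, ((degX c : K) + w - j))
      (fun i => N + (n + 1) - γ i) p = 0)
    (hΛ' : coeffFunctional (Finset.Ico (n + 1) (r + 1))
      (fun i => ∏ j ∈ Finset.range (i - (n + 1)), (-((n : K) + 2 + j)))
      (fun i => N + (n + 1) - γ i) p = 0) :
    (Bivariate.swap (telNum c v u r p)).degree < N := by
  obtain ⟨ℓ, hℓ⟩ := numer_top_of_nat hg hv0 hx hv hu hw hn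
  set V := Bivariate.swap v with hV
  -- Multiplying by x^(n+1) keeps the lowered degree bounds for i > n in the natural numbers. The
  -- top coefficients now form two proportional families, i ≤ n and i > n, each disposed of by one
  -- functional.
  let G : ℕ → K[X][Y] := fun i => X ^ (n + 1) * Bivariate.swap (numer c v u i) * V ^ (r - i)
  have hdeg : ∀ i ≤ r, (G i).natDegree ≤ γ i ∧ (G i).coeff (γ i) = if i < n + 1 then
      C (∏ j ∈ Finset.range i, ((degX c : K) + w - j)) * (lcX c * V.coeff (α + 1) ^ r)
      else C (∏ j ∈ Finset.range (i - (n + 1)), (-((n : K) + 2 + j))) *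
        (ℓ * V.coeff (α + 1) ^ (r - (n + 1))) := by
    intro i hi
    have hpow := natDegree_pow_le_of_le (r - i) hv
    rw [hγ i]
    split_ifs with h
    · obtain ⟨h1, h2⟩ := numer_top hv hu hw (c := c) i
      have h3 : (X ^ (n + 1) * Bivariate.swap (numer c v u i)).natDegree ≤
          n + 1 + (degX c + i * α) :=
        natDegree_mul_le_of_le (natDegree_X_pow_le _) h1
      have e : degX c + i * α + (r - i) * (α + 1) + (n + 1) =
        n + 1 + (degX c + i * α) + (r - i) * (α + 1) := by ring
      have hir : i + (r - i) = r := by omega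
      rw [e]
      refine ⟨natDegree_mul_le_of_le h3 hpow, ?_⟩
      rw [coeff_mul_add_eq_of_natDegree_le h3 hpow, add_comm (n + 1), coeff_X_pow_mul, h2,
        coeff_pow_of_natDegree_le hv]
      conv_rhs => rw [← hir, pow_add]
      ring
    · obtain ⟨k, rfl⟩ := Nat.exists_eq_add_of_le (not_lt.1 h)
      obtain ⟨h1, h2⟩ := hℓ k
      rw [add_zero]
      refine ⟨natDegree_mul_le_of_le h1 hpow, ?_⟩
      have hir : r - (n + 1) = k + (r - (n + 1 + k)) := by omega
      rw [coeff_mul_add_eq_of_natDegree_le h1 hpow, h2, coeff_pow_of_natDegree_le hv,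
        Nat.add_sub_cancel_left, hir, pow_add]
      ring
  obtain ⟨h1, h2⟩ := natDegree_sum_map_mul_le (fun i hi => (hdeg i hi).1) hm hp
  apply degree_lt_of_degree_X_pow_mul_lt (k := n + 1)
  have heq : X ^ (n + 1) * Bivariate.swap (telNum c v u r p) =
      ∑ i ∈ Finset.range (r + 1), (p.coeff i).map C * G i := by
    rw [swap_telNum, Finset.mul_sum]
    refine Finset.sum_congr rfl fun i _ => ?_
    simp only [G]
    ring
  rw [heq]
  refine degree_lt_of_natDegree_le_of_coeff_eq_zero h1 ?_
  rw [h2, ← Finset.sum_range_add_sum_Ico _ (show n + 1 ≤ r + 1 by omega)]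
  rw [coeffFunctional_apply] at hΛ hΛ'
  have s1 : ∑ i ∈ Finset.range (n + 1),
      C ((p.coeff i).coeff (N + (n + 1) - γ i)) * (G i).coeff (γ i) = 0 := by
    rw [← zero_mul (lcX c * V.coeff (α + 1) ^ r), ← map_zero C, ← hΛ, map_sum, Finset.sum_mul]
    refine Finset.sum_congr rfl fun i hi => ?_
    have hi' := Finset.mem_range.1 hi
    rw [(hdeg i (by omega)).2, if_pos hi', C_mul]
    ring
  have s2 : ∑ i ∈ Finset.Ico (n + 1) (r + 1),
      C ((p.coeff i).coeff (N + (n + 1) - γ i)) * (G i).coeff (γ i) = 0 := by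
    rw [← zero_mul (ℓ * V.coeff (α + 1) ^ (r - (n + 1))), ← map_zero C, ← hΛ', map_sum,
      Finset.sum_mul]
    refine Finset.sum_congr rfl fun i hi => ?_
    have hi' := Finset.mem_Ico.1 hi
    rw [(hdeg i (by omega)).2, if_neg (by omega), C_mul]
    ring
  rw [s1, s2, add_zero]

/-- Counting when `c * g` behaves like `x ^ n` at infinity with `n` a natural number. -/
theorem hasRelation_of_nat {D : DiffExt K E} {g : E} (hg : g ≠ 0) {v u u' : K[X][Y]}
    (hv : v ≠ 0) (hx : D.Dx g = embHom E u / embHom E v * g)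
    (hy : D.Dy g = embHom E u' / embHom E v * g) (c : K[X][Y]) {α Γ Sy φ r d n : ℕ} {w : K}
    (hvx : degX v ≤ α + 1) (hux : (X * Bivariate.swap u).natDegree ≤ α + 1)
    (hw : (X * Bivariate.swap u).coeff (α + 1) = C w * (Bivariate.swap v).coeff (α + 1))
    (hn : (degX c : K) + w = n) (hux' : degX u' ≤ α + 1)
    (hvy : v.natDegree ≤ Γ) (huy : u.natDegree ≤ Γ) (huy' : (X * u').natDegree ≤ Γ)
    (hSy : Sy + Γ = c.natDegree + r * Γ + 2) (hφ : φ ≤ Sy) (hfree : HasFreeExponents v u' r Sy φ)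
    (k : ℕ) (hk : k ≤ r) (hnk : n < k) (hnd : n + 1 ≤ d)
    (hcount : 2 * (((d : ℤ) + degX c + r * (α + 1) - k - (n + 1)) * (Γ + φ - 1)
      + (α + 1) * (Sy - φ) + 2) + k * (k + 1) + 2 * ((n + 1) * (n + 1))
        < 2 * ((r + 1) * (d + 1))) :
    HasRelation D (embHom E c * g) r d := by
  have hγ : ∀ i ≤ r, degX c + i * α + (r - i) * (α + 1) + i = degX c + r * (α + 1) := by
    intro i hi
    obtain ⟨j, rfl⟩ := Nat.exists_eq_add_of_le hi
    rw [Nat.add_sub_cancel_left]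
    ring
  have hkr : k ≤ r * (α + 1) := hk.trans (Nat.le_mul_of_pos_right r (Nat.succ_pos α))
  let γ : ℕ → ℕ := fun i =>
    degX c + i * α + (r - i) * (α + 1) + if i < n + 1 then n + 1 else 0
  let N : ℕ := d + degX c + r * (α + 1) - k - (n + 1)
  let Λ : Fin 2 → K[X][Y] →ₗ[K] K := ![
    coeffFunctional (Finset.range (n + 1))
      (fun i => ∏ j ∈ Finset.range i, ((degX c : K) + w - j)) (fun i => N + (n + 1) - γ i),
    coeffFunctional (Finset.Ico (n + 1) (r + 1))
      (fun i => ∏ j ∈ Finset.range (i - (n + 1)), (-((n : K) + 2 + j)))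
      (fun i => N + (n + 1) - γ i)]
  -- Only the terms with i ≤ n miss the extra drop of n + 1. Shortening these n + 1 coefficients by
  -- n + 1 lowers Ex by n + 1 at the cost of at most (n+1)² unknowns and a second functional.
  refine hasRelation_of_bounds hg hv hx hy c hvx hux' hvy huy huy' hSy hφ hfree
    (fun i => d + 1 - (k - i) - if i < n + 1 then n + 1 else 0)
    (fun i => (Nat.sub_le _ _).trans (Nat.sub_le _ _)) Λ N
    (fun p hp hΛ => swap_telNum_degree_lt_of_nat hg hv hx hvx hux hw hn (hnk.trans_le hk)
      (fun i => rfl) ?_ hp (hΛ 0) (hΛ 1)) ?_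
  · intro i hi hmi
    have := hγ i hi
    dsimp only [N] at hmi ⊢
    split_ifs at hmi ⊢ <;> omega
  · have hsum : (∑ i ∈ Finset.range (r + 1),
        ((d : ℤ) + 1 - ((k - i : ℕ) : ℤ) - if i < n + 1 then ((n : ℤ) + 1) else 0)) ≤
        ∑ i ∈ Finset.range (r + 1),
          ((d + 1 - (k - i) - if i < n + 1 then n + 1 else 0 : ℕ) : ℤ) :=
      Finset.sum_le_sum fun i _ => by split_ifs <;> omega
    have h4 : (∑ i ∈ Finset.range (r + 1), if i < n + 1 then ((n : ℤ) + 1) else 0) =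
        (n + 1) * (n + 1) := by
      have hfil : (Finset.range (r + 1)).filter (fun i => i < n + 1) = Finset.range (n + 1) := by
        ext i
        simp only [Finset.mem_filter, Finset.mem_range]
        omega
      rw [← Finset.sum_filter, hfil, Finset.sum_const, Finset.card_range, nsmul_eq_mul]
      push_cast
      ring
    rw [Finset.sum_sub_distrib, Finset.sum_sub_distrib, h4, Finset.sum_const, Finset.card_range,
      nsmul_eq_mul] at hsum
    have h2 : (∑ i ∈ Finset.range (r + 1), ((k - i : ℕ) : ℤ)) * 2 = k * (k + 1) := by
      obtain ⟨t, rfl⟩ := Nat.exists_eq_add_of_le hk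
      exact_mod_cast sum_range_const_sub_mul_two k t
    have h3 : (N : ℤ) = (d : ℤ) + degX c + r * (α + 1) - k - (n + 1) := by
      simp only [N]
      rw [Nat.cast_sub (by omega), Nat.cast_sub (by omega)]
      push_cast
      ring
    rw [h3]
    push_cast at hsum ⊢
    linarith

end CountingRelations

/-! ### The square free part as a denominator for logarithmic derivatives. -/

section Radical

-- Differentiating a prime power lowers its exponent by at most one, which the radical restores;
-- Leibniz extends this to coprime products. Consequently D(a/b) has denominator b b* instead of b².
open UniqueFactorizationMonoid in
theorem dvd_radical_mul_derivation {k R : Type*} [CommRing k] [CommRing R] [Algebra k R]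
    [UniqueFactorizationMonoid R] [NormalizationMonoid R]
    (d : Derivation k R R) (b : R) : b ∣ radical b * d b := by
  induction b using UniqueFactorizationMonoid.induction_on_coprime with
  | h0 => simp
  | h1 hu => exact hu.dvd
  | @hpr p i hp =>
    rcases i with _ | i
    · simp
    · rw [radical_pow_of_prime hp (Nat.succ_ne_zero i), d.leibniz_pow, Nat.add_sub_cancel,
        pow_succ']
      have h1 : p ∣ normalize p := (normalize_associated p).symm.dvd
      refine mul_dvd_mul h1 ?_
      rw [nsmul_eq_mul, smul_eq_mul]
      exact ⟨((i + 1 : ℕ) : R) * d p, by ring⟩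
  | @hcp x y hxy hx hy =>
    rw [radical_mul hxy, d.leibniz, smul_eq_mul, smul_eq_mul, mul_add]
    refine dvd_add ?_ ?_
    · rw [show radical x * radical y * (x * d y) = (x * radical x) * (radical y * d y) by ring]
      exact mul_dvd_mul (dvd_mul_right _ _) hy
    · rw [show radical x * radical y * (y * d x) = (radical x * d x) * (y * radical y) by ring]
      exact mul_dvd_mul hx (dvd_mul_right _ _)

variable {K : Type*} [Field K]

theorem sqfreePart_ne_zero (b : K[X][Y]) : sqfreePart b ≠ 0 := by
  let _ : StrongNormalizationMonoid K[X][Y] := UniqueFactorizationMonoid.strongNormalizationMonoid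
  exact UniqueFactorizationMonoid.radical_ne_zero

theorem exists_sqfreePart_mul_derivation (d : Derivation K K[X][Y] K[X][Y]) (b : K[X][Y]) :
    ∃ w, sqfreePart b * d b = b * w := by
  let _ : StrongNormalizationMonoid K[X][Y] := UniqueFactorizationMonoid.strongNormalizationMonoid
  exact dvd_radical_mul_derivation d b

end Radical

/-! ### Numerators of logarithmic derivatives and their behaviour at infinity. -/

section LogDerivative

/-- Numerator of `∑ εₗ cₗ' / cₗ` over the common denominator `∏ cₗ`. -/
def logNum {k R : Type*} [CommRing k] [CommRing R] [Algebra k R] (d : Derivation k R R)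
    {ι : Type*} [Fintype ι] [DecidableEq ι] (c ε : ι → R) : R :=
  ∑ l, ε l * d (c l) * ∏ j ∈ Finset.univ.erase l, c j

theorem natDegree_X_mul_logNum {S : Type*} [CommRing S] {ι : Type*} [Fintype ι]
    [DecidableEq ι] (c : ι → S[X]) (ε : ι → S) :
    (X * logNum (derivative' (R := S)) c (fun l => C (ε l))).natDegree ≤ ∑ l, (c l).natDegree ∧
    (X * logNum (derivative' (R := S)) c (fun l => C (ε l))).coeff (∑ l, (c l).natDegree) =
      (∑ l, ε l * (c l).natDegree) * (∏ l, c l).coeff (∑ l, (c l).natDegree) := by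
  have e : X * logNum (derivative' (R := S)) c (fun l => C (ε l)) =
      ∑ l, C (ε l) * ((X * derivative (c l)) * ∏ j ∈ Finset.univ.erase l, c j) := by
    rw [logNum, Finset.mul_sum]
    refine Finset.sum_congr rfl fun l _ => ?_
    change X * (C (ε l) * derivative (c l) * _) = _
    ring
  have hN : ∀ l, (c l).natDegree + ∑ j ∈ Finset.univ.erase l, (c j).natDegree =
      ∑ j, (c j).natDegree := fun l =>
    Finset.add_sum_erase _ (fun j => (c j).natDegree) (Finset.mem_univ l)
  have hP : ∀ l, (∏ j ∈ Finset.univ.erase l, c j).natDegree ≤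
      ∑ j ∈ Finset.univ.erase l, (c j).natDegree := fun l => natDegree_prod_le _ _
  rw [e]
  constructor
  · refine natDegree_sum_le_of_forall_le _ _ fun l _ => (natDegree_C_mul_le _ _).trans ?_
    rw [← hN l]
    exact natDegree_mul_le_of_le (natDegree_X_mul_derivative_le le_rfl) (hP l)
  · rw [finsetSum_coeff, Finset.sum_mul]
    refine Finset.sum_congr rfl fun l _ => ?_
    rw [← Finset.mul_prod_erase _ c (Finset.mem_univ l), ← hN l, coeff_C_mul,
      coeff_mul_add_eq_of_natDegree_le (natDegree_X_mul_derivative_le le_rfl) (hP l),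
      coeff_mul_add_eq_of_natDegree_le le_rfl (hP l), coeff_X_mul_derivative]
    ring

/-- The Euler operator X d/dX multiplies a leading term by its degree, so the top coefficient is
governed by the difference of the degrees. It vanishes when they agree. -/
theorem natDegree_X_mul_wronskian {S : Type*} [CommRing S] (a b : S[X]) :
    (X * (derivative a * b - a * derivative b)).natDegree ≤ a.natDegree + b.natDegree ∧
    (X * (derivative a * b - a * derivative b)).coeff (a.natDegree + b.natDegree) =
      ((a.natDegree : S) - b.natDegree) * (a.leadingCoeff * b.leadingCoeff) := by
  have e : X * (derivative a * b - a * derivative b) =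
      (X * derivative a) * b - a * (X * derivative b) := by ring
  rw [e]
  have ha := natDegree_X_mul_derivative_le (le_refl a.natDegree)
  have hb := natDegree_X_mul_derivative_le (le_refl b.natDegree)
  refine ⟨(natDegree_sub_le_of_le (natDegree_mul_le_of_le ha le_rfl)
    (natDegree_mul_le_of_le le_rfl hb)).trans (max_self _).le, ?_⟩
  rw [coeff_sub, coeff_mul_add_eq_of_natDegree_le ha le_rfl,
    coeff_mul_add_eq_of_natDegree_le le_rfl hb, coeff_X_mul_derivative, coeff_X_mul_derivative]
  simp only [coeff_natDegree]
  ring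

theorem degree_lt_of_mul_eq_mul {S : Type*} [CommRing S] [IsDomain S] {b P s Q : S[X]} {q : ℕ}
    (hb : b ≠ 0) (h : b * P = s * Q) (hQ : Q.degree < ((q + b.natDegree : ℕ) : WithBot ℕ)) :
    P.degree < ((s.natDegree + q : ℕ) : WithBot ℕ) := by
  rcases eq_or_ne P 0 with rfl | hP
  · simp
  have hsQ : s * Q ≠ 0 := h ▸ mul_ne_zero hb hP
  rw [← natDegree_lt_iff_degree_lt (right_ne_zero_of_mul hsQ)] at hQ
  rw [← natDegree_lt_iff_degree_lt hP]
  have := congrArg natDegree h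
  rw [natDegree_mul hb hP, natDegree_mul (left_ne_zero_of_mul hsQ) (right_ne_zero_of_mul hsQ)]
    at this
  omega

theorem natDegree_le_of_mul_eq_mul {S : Type*} [CommRing S] [IsDomain S] {b P s Q : S[X]} {q : ℕ}
    (hb : b ≠ 0) (h : b * P = s * Q) (hQ : Q.natDegree ≤ q + b.natDegree) :
    P.natDegree ≤ s.natDegree + q := by
  rcases eq_or_ne P 0 with rfl | hP
  · simp
  have hsQ : s * Q ≠ 0 := h ▸ mul_ne_zero hb hP
  have := congrArg natDegree h
  rw [natDegree_mul hb hP, natDegree_mul (left_ne_zero_of_mul hsQ) (right_ne_zero_of_mul hsQ)]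
    at this
  omega

end LogDerivative

section SwapDerivative

variable {K : Type*} [Field K]

theorem swap_derivative (p : K[X][Y]) :
    Bivariate.swap (derivative p) = dX (Bivariate.swap p) := by
  rw [dX_apply, Bivariate.swap_swap_apply]

theorem swap_logNum_dX {ι : Type*} [Fintype ι] [DecidableEq ι] (c : ι → K[X][Y]) (e : ι → K) :
    Bivariate.swap (logNum dX c fun l => C (C (e l))) =
      logNum (derivative' (R := K[X])) (fun l => Bivariate.swap (c l)) fun l => C (C (e l)) := by
  simp only [logNum, map_sum, map_mul, map_prod, Bivariate.swap_C_C, swap_dX]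
  rfl

theorem degX_dY_le (p : K[X][Y]) : degX (dY p) ≤ degX p := degX_derivative_le p

theorem natDegree_logNum_dX_le {ι : Type*} [Fintype ι] [DecidableEq ι] (c : ι → K[X][Y])
    (e : ι → K) : (logNum dX c fun l => C (C (e l))).natDegree ≤ ∑ l, (c l).natDegree := by
  refine natDegree_sum_le_of_forall_le _ _ fun l _ => ?_
  rw [mul_assoc, ← Finset.add_sum_erase _ (fun j => (c j).natDegree) (Finset.mem_univ l)]
  exact (natDegree_C_mul_le _ _).trans
    (natDegree_mul_le_of_le (natDegree_dX_le _) (natDegree_prod_le _ _))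

theorem degX_logNum_dY_le {ι : Type*} [Fintype ι] [DecidableEq ι] (c : ι → K[X][Y])
    (e : ι → K) : degX (logNum dY c fun l => C (C (e l))) ≤ ∑ l, degX (c l) := by
  rw [degX, logNum, map_sum]
  refine natDegree_sum_le_of_forall_le _ _ fun l _ => ?_
  rw [map_mul, map_mul, Bivariate.swap_C_C, map_prod, mul_assoc,
    ← Finset.add_sum_erase _ (fun j => degX (c j)) (Finset.mem_univ l)]
  exact (natDegree_C_mul_le _ _).trans
    (natDegree_mul_le_of_le (degX_dY_le _) (natDegree_prod_le _ _))

end SwapDerivative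

/-! ### Logarithmic derivatives of the given term: numerators, denominator, degrees. -/

namespace TermData

variable {K : Type*} [Field K] (H : TermData K)

/-- The product `∏ cₗ`. -/
def prodC : K[X][Y] := ∏ l, H.c l

theorem prodC_ne : H.prodC ≠ 0 := Finset.prod_ne_zero_iff.2 fun l _ => H.c_ne l

/-- The numerator of `d (a / b)` over the denominator `b * sqfreePart b`. -/
def expNum (d : Derivation K K[X][Y] K[X][Y]) : K[X][Y] :=
  d H.a * sqfreePart H.b - H.a * (exists_sqfreePart_mul_derivation d H.b).choose

theorem b_mul_expNum (d : Derivation K K[X][Y] K[X][Y]) :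
    H.b * H.expNum d = sqfreePart H.b * (d H.a * H.b - H.a * d H.b) := by
  have h := (exists_sqfreePart_mul_derivation d H.b).choose_spec
  rw [expNum]
  linear_combination H.a * h

/-- The common denominator of the logarithmic derivatives of `exp (a / b) ∏ cₗ ^ eₗ`. -/
def den : K[X][Y] := H.b * sqfreePart H.b * H.prodC

theorem den_ne : H.den ≠ 0 :=
  mul_ne_zero (mul_ne_zero H.b_ne (sqfreePart_ne_zero _)) H.prodC_ne

/-- The numerators of the logarithmic derivatives of `∏ cₗ ^ eₗ`. -/
def powNum (d : Derivation K K[X][Y] K[X][Y]) : K[X][Y] :=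
  logNum d H.c fun l => C (C (H.e l))

/-- The numerators of the logarithmic derivatives of `exp (a / b) ∏ cₗ ^ eₗ`. -/
def num (d : Derivation K K[X][Y] K[X][Y]) : K[X][Y] :=
  H.expNum d * H.prodC + H.b * sqfreePart H.b * H.powNum d

theorem degX_prodC : degX H.prodC = ∑ l, degX (H.c l) := degX_prod _ _ fun l _ => H.c_ne l

theorem natDegree_prodC : H.prodC.natDegree = ∑ l, (H.c l).natDegree :=
  natDegree_prod _ _ fun l _ => H.c_ne l

theorem degX_den : degX H.den = H.alpha := by
  rw [den, degX_mul (mul_ne_zero H.b_ne (sqfreePart_ne_zero _)) H.prodC_ne,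
    degX_mul H.b_ne (sqfreePart_ne_zero _), degX_prodC, alpha, add_comm (degX H.b)]

theorem natDegree_den :
    H.den.natDegree = H.b.natDegree + (sqfreePart H.b).natDegree + ∑ l, (H.c l).natDegree := by
  rw [den, natDegree_mul (mul_ne_zero H.b_ne (sqfreePart_ne_zero _)) H.prodC_ne,
    natDegree_mul H.b_ne (sqfreePart_ne_zero _), natDegree_prodC]

theorem natDegree_den_le : H.den.natDegree ≤ H.gamma := by
  rw [natDegree_den, gamma, degY, degY, degY]
  have : ∑ l, degY (H.c l) = ∑ l, (H.c l).natDegree := rfl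
  omega

theorem natDegree_le_gamma_of {P Q q : K[X][Y]} (hP : P.natDegree ≤
      (sqfreePart H.b).natDegree + max H.a.natDegree H.b.natDegree)
    (hQ : Q.natDegree ≤ ∑ l, (H.c l).natDegree) (hq : q = P * H.prodC + H.b * sqfreePart H.b * Q) :
    q.natDegree ≤ H.gamma := by
  rw [hq]
  refine (natDegree_add_le_of_le (natDegree_mul_le_of_le hP H.natDegree_prodC.le)
    (natDegree_mul_le_of_le (natDegree_mul_le_of_le le_rfl le_rfl) hQ)).trans ?_
  have : ∑ l, degY (H.c l) = ∑ l, (H.c l).natDegree := rfl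
  rw [gamma, degY, degY, degY, this]
  omega

theorem natDegree_num_dX_le : (H.num dX).natDegree ≤ H.gamma := by
  refine H.natDegree_le_gamma_of ?_ (natDegree_logNum_dX_le _ _) rfl
  refine natDegree_le_of_mul_eq_mul H.b_ne (H.b_mul_expNum dX) ?_
  refine (natDegree_sub_le_of_le (natDegree_mul_le_of_le (natDegree_dX_le _) le_rfl)
    (natDegree_mul_le_of_le le_rfl (natDegree_dX_le _))).trans ?_
  omega

theorem natDegree_X_mul_num_dY_le : (X * H.num dY).natDegree ≤ H.gamma := by
  refine H.natDegree_le_gamma_of (P := X * H.expNum dY) (Q := X * H.powNum dY) ?_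
    (natDegree_X_mul_logNum H.c fun l => C (H.e l)).1 (by rw [num]; ring)
  have h : H.b * (X * H.expNum dY) =
      sqfreePart H.b * (X * (derivative H.a * H.b - H.a * derivative H.b)) := by
    rw [← mul_assoc, mul_comm H.b, mul_assoc, H.b_mul_expNum dY, dY_apply, dY_apply]
    ring
  refine natDegree_le_of_mul_eq_mul H.b_ne h ((natDegree_X_mul_wronskian _ _).1.trans ?_)
  omega

theorem swap_num (d : Derivation K K[X][Y] K[X][Y]) :
    Bivariate.swap (H.num d) = Bivariate.swap (H.expNum d) * Bivariate.swap H.prodC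
      + Bivariate.swap H.b * Bivariate.swap (sqfreePart H.b) * Bivariate.swap (H.powNum d) := by
  simp only [num, map_add, map_mul]

theorem swap_b_mul_X_mul_expNum :
    Bivariate.swap H.b * (X * Bivariate.swap (H.expNum dX)) =
      Bivariate.swap (sqfreePart H.b) * (X * (derivative (Bivariate.swap H.a) * Bivariate.swap H.b
        - Bivariate.swap H.a * derivative (Bivariate.swap H.b))) := by
  have := congrArg Bivariate.swap (H.b_mul_expNum dX)
  simp only [map_mul, map_sub, swap_dX] at this
  linear_combination X * this

theorem swap_b_mul_expNum_dY :
    Bivariate.swap H.b * Bivariate.swap (H.expNum dY) =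
      Bivariate.swap (sqfreePart H.b) * (dX (Bivariate.swap H.a) * Bivariate.swap H.b
        - Bivariate.swap H.a * dX (Bivariate.swap H.b)) := by
  have := congrArg Bivariate.swap (H.b_mul_expNum dY)
  simpa only [map_mul, map_sub, dY_apply, swap_derivative] using this

/-- The part `∑ eₗ deg_x cₗ` of `ω`. -/
def omegaPow : K := ∑ l, H.e l * (degX (H.c l) : K)

theorem omega_eq : H.omega = degX H.c₀ + H.omegaPow := rfl

theorem natDegree_X_mul_swap_powNum :
    (X * Bivariate.swap (H.powNum dX)).natDegree ≤ degX H.prodC ∧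
      (X * Bivariate.swap (H.powNum dX)).coeff (degX H.prodC) =
        C H.omegaPow * (Bivariate.swap H.prodC).coeff (degX H.prodC) := by
  have := natDegree_X_mul_logNum (fun l => Bivariate.swap (H.c l)) fun l => C (H.e l)
  rw [degX_prodC, powNum, swap_logNum_dX, omegaPow, prodC, map_prod, map_sum]
  simp only [map_mul, map_natCast]
  exact this

theorem degX_num_dX_le {β : ℕ} (h : degX H.a = degX H.b + β + 1) :
    degX (H.num dX) ≤ H.alpha + β := by
  have h1 : (X * Bivariate.swap (H.expNum dX)).natDegree ≤
      degX (sqfreePart H.b) + (degX H.b + β + 1) :=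
    natDegree_le_of_mul_eq_mul (swap_ne_zero H.b_ne) H.swap_b_mul_X_mul_expNum
      ((natDegree_X_mul_wronskian _ _).1.trans (add_le_add_left h.le _))
  apply natDegree_le_of_natDegree_X_mul_le
  have e : X * Bivariate.swap (H.num dX) =
      (X * Bivariate.swap (H.expNum dX)) * Bivariate.swap H.prodC
      + Bivariate.swap H.b * Bivariate.swap (sqfreePart H.b)
        * (X * Bivariate.swap (H.powNum dX)) := by
    rw [swap_num]
    ring
  rw [e]
  refine (natDegree_add_le_of_le (natDegree_mul_le_of_le h1 le_rfl)
    (natDegree_mul_le_of_le (natDegree_mul_le_of_le le_rfl le_rfl)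
      H.natDegree_X_mul_swap_powNum.1)).trans ?_
  have h2 : (Bivariate.swap H.prodC).natDegree = ∑ l, degX (H.c l) := H.degX_prodC
  rw [h2, degX_prodC, alpha]
  simp only [degX]
  omega

theorem degX_num_dY_le {M : ℕ} (hM : degX (H.expNum dY) ≤ degX (sqfreePart H.b) + M)
    (hb : degX H.b ≤ M) :
    degX (H.num dY) ≤ degX (sqfreePart H.b) + M + ∑ l, degX (H.c l) := by
  rw [degX, swap_num]
  refine (natDegree_add_le_of_le (natDegree_mul_le_of_le hM H.degX_prodC.le)
    (natDegree_mul_le_of_le (natDegree_mul_le_of_le le_rfl le_rfl)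
      (degX_logNum_dY_le _ _))).trans ?_
  simp only [degX] at hb ⊢
  omega

theorem degX_expNum_dY_le :
    degX (H.expNum dY) ≤ degX (sqfreePart H.b) + degX H.a := by
  refine natDegree_le_of_mul_eq_mul (swap_ne_zero H.b_ne) H.swap_b_mul_expNum_dY ?_
  exact (natDegree_sub_le_of_le (natDegree_mul_le_of_le (natDegree_dX_le _) le_rfl)
    (natDegree_mul_le_of_le le_rfl (natDegree_dX_le _))).trans (max_self _).le

theorem degX_num_dY_le_of_lt {β : ℕ} (h : degX H.a = degX H.b + β + 1) :
    degX (H.num dY) ≤ H.alpha + β + 1 := by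
  refine (H.degX_num_dY_le H.degX_expNum_dY_le (by omega)).trans ?_
  rw [alpha]
  omega

theorem degX_num_dY_le_of_le (h : degX H.a ≤ degX H.b) : degX (H.num dY) ≤ H.alpha := by
  refine (H.degX_num_dY_le (M := degX H.b) (H.degX_expNum_dY_le.trans ?_) le_rfl).trans ?_
  · omega
  · rw [alpha]

/-- The top x-coefficient of the y-Wronskian of a and b is the Wronskian of lc_x a and lc_x b. It
vanishes when their quotient is constant, which gains one degree and accounts for φ₁. -/
theorem degX_num_dY_le_of_lcQuotConst {β : ℕ} (h : degX H.a = degX H.b + β + 1)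
    (hlc : H.LcQuotConst) : degX (H.num dY) ≤ H.alpha + β := by
  have hW : (dX (Bivariate.swap H.a) * Bivariate.swap H.b
        - Bivariate.swap H.a * dX (Bivariate.swap H.b)).degree <
      ((degX H.a + degX H.b : ℕ) : WithBot ℕ) := by
    have ha := natDegree_dX_le (Bivariate.swap H.a)
    have hb := natDegree_dX_le (Bivariate.swap H.b)
    refine degree_lt_of_natDegree_le_of_coeff_eq_zero
      ((natDegree_sub_le_of_le (natDegree_mul_le_of_le ha le_rfl)
        (natDegree_mul_le_of_le le_rfl hb)).trans (max_self _).le) ?_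
    obtain ⟨k, hk⟩ := hlc
    rw [coeff_sub, degX, degX, coeff_mul_add_eq_of_natDegree_le ha le_rfl,
      coeff_mul_add_eq_of_natDegree_le le_rfl hb, coeff_dX, coeff_dX]
    change derivative (lcX H.a) * lcX H.b - lcX H.a * derivative (lcX H.b) = 0
    rw [hk, derivative_C_mul]
    ring
  have hlt := degree_lt_of_mul_eq_mul (swap_ne_zero H.b_ne) H.swap_b_mul_expNum_dY hW
  have hle : degX (H.expNum dY) ≤ degX (sqfreePart H.b) + (degX H.b + β) := by
    rw [degX, natDegree_le_iff_coeff_eq_zero]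
    rw [degree_lt_iff_coeff_zero] at hlt
    intro n hn
    refine hlt n ?_
    simp only [degX] at hn h ⊢
    omega
  refine (H.degX_num_dY_le hle (by omega)).trans ?_
  rw [alpha]
  omega

/-- At x = ∞ the quotient a/b stays bounded, so x D_x(a/b) tends to 0. Only the powers contribute to
the limit of x (D_x g)/g, namely ∑ e_ℓ deg_x c_ℓ. -/
theorem degree_X_mul_num_sub_lt (h : degX H.a ≤ degX H.b) :
    (X * Bivariate.swap (H.num dX) - C (C H.omegaPow) * Bivariate.swap H.den).degree <
      (H.alpha : WithBot ℕ) := by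
  have hW : (X * (derivative (Bivariate.swap H.a) * Bivariate.swap H.b
        - Bivariate.swap H.a * derivative (Bivariate.swap H.b))).degree <
      ((degX H.b + degX H.b : ℕ) : WithBot ℕ) := by
    obtain ⟨h1, h2⟩ := natDegree_X_mul_wronskian (Bivariate.swap H.a) (Bivariate.swap H.b)
    rcases h.lt_or_eq with h | h
    · refine (degree_le_natDegree.trans (Nat.cast_le.2 h1)).trans_lt ?_
      exact_mod_cast Nat.add_lt_add_right h _
    · change _ ≤ degX H.a + degX H.b at h1
      change coeff _ (degX H.a + degX H.b) =
        ((degX H.a : K[X]) - (degX H.b : K[X])) * _ at h2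
      rw [h] at h1 h2
      refine degree_lt_of_natDegree_le_of_coeff_eq_zero h1 ?_
      rw [h2]
      ring
  have h1 := degree_lt_of_mul_eq_mul (swap_ne_zero H.b_ne) H.swap_b_mul_X_mul_expNum hW
  obtain ⟨p1, p2⟩ := H.natDegree_X_mul_swap_powNum
  have h2 : (X * Bivariate.swap (H.powNum dX)
      - C (C H.omegaPow) * Bivariate.swap H.prodC).degree <
      (degX H.prodC : WithBot ℕ) := by
    refine degree_lt_of_natDegree_le_of_coeff_eq_zero
      ((natDegree_sub_le_of_le p1 (natDegree_C_mul_le _ _)).trans (max_self _).le) ?_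
    rw [coeff_sub, coeff_C_mul, p2]
    ring
  have e : X * Bivariate.swap (H.num dX) - C (C H.omegaPow) * Bivariate.swap H.den =
      (X * Bivariate.swap (H.expNum dX)) * Bivariate.swap H.prodC
      + Bivariate.swap H.b * Bivariate.swap (sqfreePart H.b) * (X * Bivariate.swap (H.powNum dX)
      - C (C H.omegaPow) * Bivariate.swap H.prodC) := by
    rw [swap_num, den, map_mul, map_mul]
    ring
  rw [e]
  have hp : ∀ q : K[X][Y], q ≠ 0 → (Bivariate.swap q).degree = degX q := fun q hq =>
    degree_eq_natDegree (swap_ne_zero hq)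
  refine (degree_add_le _ _).trans_lt (max_lt ?_ ?_)
  · rw [degree_mul, hp _ H.prodC_ne, alpha, ← degX_prodC, Nat.cast_add]
    exact WithBot.add_lt_add_right (WithBot.coe_ne_bot) h1
  · rw [degree_mul, degree_mul, hp _ H.b_ne, hp _ (sqfreePart_ne_zero _), alpha, ← degX_prodC,
      Nat.cast_add, Nat.cast_add, add_comm (degX H.b : WithBot ℕ)]
    exact WithBot.add_lt_add_left (by exact WithBot.coe_ne_bot) h2

end TermData

/-! ### Poles and residues in y. -/

section Residues

theorem prod_erase_eq_prod_ite {M ι : Type*} [CommMonoid M] [Fintype ι] [DecidableEq ι]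
    (c : ι → M) (l : ι) :
    ∏ j ∈ Finset.univ.erase l, c j = ∏ j, if j = l then 1 else c j := by
  rw [← Finset.prod_erase Finset.univ (a := l) (by simp)]
  exact Finset.prod_congr rfl fun j hj => by rw [if_neg (Finset.ne_of_mem_erase hj)]

theorem logNum_option {k R : Type*} [CommRing k] [CommRing R] [Algebra k R]
    (d : Derivation k R R) {ι : Type*} [Fintype ι] [DecidableEq ι] (c ε : Option ι → R) :
    logNum d c ε = ε none * d (c none) * ∏ l, c (some l)
      + c none * logNum d (fun l => c (some l)) fun l => ε (some l) := by
  simp only [logNum, prod_erase_eq_prod_ite, Fintype.sum_option, Fintype.prod_option, Finset.mul_sum]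
  simp only [reduceCtorEq, if_true, if_false, Option.some.injEq, one_mul]
  congr 1
  exact Finset.sum_congr rfl fun l _ => by ring

/-- This isolates the principal part at p: the residue ∑ ε_l m_l multiplies d p, and the rest
carries a factor p. -/
theorem mul_logNum_pow_mul {k R : Type*} [CommRing k] [CommRing R] [Algebra k R]
    (d : Derivation k R R) {ι : Type*} [Fintype ι] [DecidableEq ι] (f ε : ι → R) (p : R)
    (m : ι → ℕ) :
    p * logNum d (fun l => p ^ m l * f l) ε = p ^ (∑ l, m l) *
      ((∑ l, ε l * m l) * d p * ∏ l, f l + p * logNum d f ε) := by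
  rw [mul_add, logNum, logNum, Finset.mul_sum, Finset.sum_mul, Finset.sum_mul, Finset.mul_sum,
    Finset.mul_sum, Finset.mul_sum, ← Finset.sum_add_distrib]
  refine Finset.sum_congr rfl fun l _ => ?_
  rw [Finset.prod_mul_distrib, Finset.prod_pow_eq_pow_sum,
    ← Finset.mul_prod_erase Finset.univ f (Finset.mem_univ l),
    ← Finset.add_sum_erase Finset.univ m (Finset.mem_univ l), pow_add, d.leibniz, d.leibniz_pow]
  simp only [smul_eq_mul, nsmul_eq_mul]
  rcases m l with _ | n
  · simp only [pow_zero, Nat.cast_zero]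
    ring
  · simp only [Nat.add_sub_cancel]
    ring

variable {K : Type*} [Field K]

theorem not_dvd_C_C {p : K[X][Y]} (hp : Prime p) {k : K} (hk : k ≠ 0) : ¬ p ∣ C (C k) := fun h =>
  hp.not_isUnit (isUnit_of_dvd_unit h ((hk.isUnit.map C).map C))

theorem not_dvd_derivative [CharZero K] {p : K[X][Y]} (hp : p.natDegree ≠ 0) :
    ¬ p ∣ derivative p := fun h =>
  (natDegree_le_of_dvd h (derivative_ne_zero hp)).not_gt (natDegree_derivative_lt hp)

theorem exists_prime_dvd_of_natDegree_ne_zero {f : K[X][Y]} (hf : f.natDegree ≠ 0) :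
    ∃ p, Prime p ∧ p ∣ f ∧ p.natDegree ≠ 0 := by
  induction f using UniqueFactorizationMonoid.induction_on_prime with
  | h₁ => simp at hf
  | h₂ x hx => exact absurd (natDegree_eq_zero_of_isUnit hx) hf
  | h₃ a p ha hp ih =>
    by_cases h : p.natDegree = 0
    · have : a.natDegree ≠ 0 := by
        rwa [natDegree_mul hp.ne_zero ha, h, zero_add] at hf
      obtain ⟨q, hq, hqa, hq0⟩ := ih this
      exact ⟨q, hq, hqa.mul_left p, hq0⟩
    · exact ⟨p, hp, dvd_mul_right _ _, h⟩

section

variable [CharZero K] {ι : Type*} [Fintype ι] [DecidableEq ι] {a b : K[X][Y]} {F : ι → K[X][Y]}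
  {ε : ι → K}

/-- If `(a / b)'` is a combination of logarithmic derivatives, a primitive pole of `a / b` is
impossible. -/
theorem dvd_num_of_dvd_den (hb : b ≠ 0) (hF : ∀ l, F l ≠ 0)
    (h : (derivative a * b - a * derivative b) * ∏ l, F l =
      -(b ^ 2 * logNum dY F fun l => C (C (ε l)))) {p : K[X][Y]} (hp : Prime p)
    (hp0 : p.natDegree ≠ 0) (hpb : p ∣ b) : p ∣ a := by
  by_contra hpa
  choose m f hf hmf using fun l => WfDvdMonoid.max_power_factor (hF l) hp.irreducible
  obtain ⟨n, b₁, hb₁, rfl⟩ := WfDvdMonoid.max_power_factor hb hp.irreducible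
  have hn : n ≠ 0 := by
    rintro rfl
    exact hb₁ (by simpa using hpb)
  obtain ⟨n, rfl⟩ := Nat.exists_eq_succ_of_ne_zero hn
  have hFeq : F = fun l => p ^ m l * f l := funext hmf
  have hlog := mul_logNum_pow_mul dY f (fun l => C (C (ε l))) p m
  rw [← hFeq] at hlog
  have hprod : ∏ l, F l = p ^ (∑ l, m l) * ∏ l, f l := by
    rw [hFeq, Finset.prod_mul_distrib, Finset.prod_pow_eq_pow_sum]
  rw [hprod, derivative_mul, derivative_pow, Nat.succ_eq_add_one, Nat.add_sub_cancel] at h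
  -- A pole of a/b of order n + 1 gives (a/b)' a pole of order n + 2 ≥ 2, whereas logarithmic
  -- derivatives have only simple poles. After clearing denominators, the leading part of that pole
  -- must be divisible by p.
  have key : p ^ (∑ l, m l) * p ^ (n + 1) * (((n + 1 : ℕ) : K[X][Y]) * (a * derivative p * b₁ * ∏ l, f l)) =
      p ^ (∑ l, m l) * p ^ (n + 1) * (p * ((derivative a * b₁ - a * derivative b₁) * (∏ l, f l)
        + p ^ n * b₁ ^ 2 * ((∑ l, C (C (ε l)) * m l) * dY p * ∏ l, f l
          + p * logNum dY f fun l => C (C (ε l))))) := by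
    simp only [map_natCast] at h ⊢
    linear_combination (-p) * h + p ^ (n + 1) * p ^ (n + 1) * b₁ ^ 2 * hlog
  have hpow : p ^ (∑ l, m l) * p ^ (n + 1) ≠ 0 :=
    mul_ne_zero (pow_ne_zero _ hp.ne_zero) (pow_ne_zero _ hp.ne_zero)
  have hdvd := Dvd.intro _ (mul_left_cancel₀ hpow key).symm
  have hnat : ¬ p ∣ ((n + 1 : ℕ) : K[X][Y]) := by
    have := not_dvd_C_C hp (k := ((n + 1 : ℕ) : K)) (Nat.cast_ne_zero.2 n.succ_ne_zero)
    simpa only [map_natCast] using this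
  rcases hp.dvd_or_dvd hdvd with h1 | h1
  · exact hnat h1
  rcases hp.dvd_or_dvd h1 with h1 | h1
  · rcases hp.dvd_or_dvd h1 with h1 | h1
    · rcases hp.dvd_or_dvd h1 with h1 | h1
      · exact hpa h1
      · exact not_dvd_derivative hp0 h1
    · exact hb₁ h1
  · obtain ⟨l, -, hl⟩ := (hp.dvd_finsetProd_iff _).1 h1
    exact hf l hl

/-- Where a/b is regular, so is (a/b)', and the residue of the combination of logarithmic
derivatives has to vanish. -/
theorem sum_residue_eq_zero (h : (derivative a * b - a * derivative b) * ∏ l, F l =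
      -(b ^ 2 * logNum dY F fun l => C (C (ε l)))) {p : K[X][Y]} (hp : Prime p)
    (hp0 : p.natDegree ≠ 0) (hpb : ¬ p ∣ b) {m : ι → ℕ} {f : ι → K[X][Y]}
    (hf : ∀ l, ¬ p ∣ f l) (hmf : ∀ l, F l = p ^ m l * f l) : ∑ l, ε l * m l = 0 := by
  by_contra hne
  have hFeq : F = fun l => p ^ m l * f l := funext hmf
  have hlog := mul_logNum_pow_mul dY f (fun l => C (C (ε l))) p m
  rw [← hFeq] at hlog
  have hprod : ∏ l, F l = p ^ (∑ l, m l) * ∏ l, f l := by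
    rw [hFeq, Finset.prod_mul_distrib, Finset.prod_pow_eq_pow_sum]
  rw [hprod] at h
  have hsum : (∑ l, C (C (ε l)) * (m l : K[X][Y])) = C (C (∑ l, ε l * m l)) := by
    simp only [map_sum, map_mul, map_natCast]
  rw [hsum] at hlog
  have key : p ^ (∑ l, m l) * (C (C (∑ l, ε l * m l)) * (b ^ 2 * derivative p * ∏ l, f l)) =
      p ^ (∑ l, m l) * (p * (-((derivative a * b - a * derivative b) * ∏ l, f l)
        - b ^ 2 * logNum dY f fun l => C (C (ε l)))) := by
    rw [dY_apply] at hlog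
    linear_combination p * h - b ^ 2 * hlog
  have hdvd := Dvd.intro _ (mul_left_cancel₀ (pow_ne_zero _ hp.ne_zero) key).symm
  rcases hp.dvd_or_dvd hdvd with h1 | h1
  · exact not_dvd_C_C hp hne h1
  rcases hp.dvd_or_dvd h1 with h1 | h1
  · rcases hp.dvd_or_dvd h1 with h1 | h1
    · exact hpb (hp.dvd_of_dvd_pow h1)
    · exact not_dvd_derivative hp0 h1
  · obtain ⟨l, -, hl⟩ := (hp.dvd_finsetProd_iff _).1 h1
    exact hf l hl

-- This is the comparison at y = ∞. With b free of y, the derivative of a/b is a polynomial in y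
-- over K(x), while the logarithmic derivatives vanish at infinity; both sides are therefore 0, and
-- the coefficient of 1/y is the weighted sum of degrees.
omit [CharZero K] in
theorem derivative_eq_zero_of_logNum (hb : b.natDegree = 0) (hb0 : b ≠ 0) (hF : ∀ l, F l ≠ 0)
    (h : (derivative a * b - a * derivative b) * ∏ l, F l =
      -(b ^ 2 * logNum dY F fun l => C (C (ε l)))) :
    derivative a = 0 ∧ ∑ l, ε l * (F l).natDegree = 0 := by
  have hb' : derivative b = 0 := derivative_of_natDegree_zero hb
  have hprod : ∏ l, F l ≠ 0 := Finset.prod_ne_zero_iff.2 fun l _ => hF l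
  obtain ⟨h1, h2⟩ := natDegree_X_mul_logNum F fun l => C (ε l)
  have hX : X * derivative a * ∏ l, F l = -(b * (X * logNum dY F fun l => C (C (ε l)))) := by
    apply mul_left_cancel₀ hb0
    rw [hb'] at h
    linear_combination X * h
  have ha : derivative a = 0 := by
    by_contra ha
    have hdeg := congrArg natDegree hX
    rw [natDegree_mul (mul_ne_zero X_ne_zero ha) hprod, natDegree_X_mul ha, natDegree_neg,
      natDegree_prod _ _ fun l _ => hF l] at hdeg
    have hle : (b * (X * logNum dY F fun l => C (C (ε l)))).natDegree ≤
        0 + ∑ l, (F l).natDegree := natDegree_mul_le_of_le hb.le h1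
    omega
  refine ⟨ha, ?_⟩
  rw [ha, mul_zero, zero_mul, eq_comm, neg_eq_zero, mul_eq_zero, or_iff_right hb0] at hX
  change (X * logNum dY F fun l => C (C (ε l))).coeff _ = _ at h2
  rw [hX, coeff_zero, eq_comm, ← natDegree_prod _ _ fun l _ => hF l, coeff_natDegree, mul_eq_zero,
    or_iff_left (leadingCoeff_ne_zero.2 hprod)] at h2
  apply C_injective
  simpa only [map_sum, map_mul, map_natCast, map_zero] using h2

/-- In lowest terms, a prime of positive y-degree in the denominator would also divide the numerator
by `dvd_num_of_dvd_den`. The reduced denominator is thus free of y. -/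
theorem exists_reduced_den (hb : b ≠ 0) (hF : ∀ l, F l ≠ 0)
    (h : (derivative a * b - a * derivative b) * ∏ l, F l =
      -(b ^ 2 * logNum dY F fun l => C (C (ε l)))) :
    ∃ (a' : K[X][Y]) (q : K[X]), q ≠ 0 ∧ a * C q = b * a' ∧
      (derivative a' * C q - a' * derivative (C q)) * ∏ l, F l =
        -(C q ^ 2 * logNum dY F fun l => C (C (ε l))) := by
  obtain ⟨a', b', t, hrel, rfl, rfl⟩ := UniqueFactorizationMonoid.exists_reduced_factors' a b hb
  have ht : t ≠ 0 := left_ne_zero_of_mul hb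
  have hb' : b' ≠ 0 := right_ne_zero_of_mul hb
  have h' : (derivative a' * b' - a' * derivative b') * ∏ l, F l =
      -(b' ^ 2 * logNum dY F fun l => C (C (ε l))) := by
    apply mul_left_cancel₀ (pow_ne_zero 2 ht)
    rw [derivative_mul, derivative_mul] at h
    linear_combination h
  have hdeg : b'.natDegree = 0 := by
    by_contra h0
    obtain ⟨p, hp, hpb, hp0⟩ := exists_prime_dvd_of_natDegree_ne_zero h0
    exact hp.not_isUnit (hrel (dvd_num_of_dvd_den hb' hF h' hp hp0 hpb) hpb)
  have hC := eq_C_of_natDegree_eq_zero hdeg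
  refine ⟨a', b'.coeff 0, fun h0 => hb' (by rw [hC, h0, C_0]), ?_, ?_⟩
  · rw [← hC]
    ring
  · rwa [← hC]

end

end Residues

/-! ### The kernel of the certificate map. -/

section FreeExponents

variable {K : Type*} [Field K] [CharZero K]

/-- Two solutions of a first order linear equation have zero Wronskian, whose top coefficient
contains the difference of the degrees. Excluding this single exponent therefore excludes every
nonzero solution. -/
theorem natDegree_eq_of_certOp_eq_zero {v u' : K[X][Y]} (hv : v ≠ 0) {r : ℕ} {s t : K[X][Y]}
    (hs : s ≠ 0) (ht : t ≠ 0) (h : certOp v u' r s = 0) (h' : certOp v u' r t = 0) :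
    s.natDegree = t.natDegree := by
  rw [certOp_apply] at h h'
  have hW : X * (derivative s * t - s * derivative t) = 0 := by
    apply mul_left_cancel₀ hv
    linear_combination X * t * h - X * s * h'
  have := (natDegree_X_mul_wronskian s t).2
  rw [hW, coeff_zero, eq_comm, mul_eq_zero, or_iff_left (mul_ne_zero (leadingCoeff_ne_zero.2 hs)
    (leadingCoeff_ne_zero.2 ht)), sub_eq_zero] at this
  exact_mod_cast this

theorem hasFreeExponents_one {v : K[X][Y]} (u' : K[X][Y]) (hv : v ≠ 0) (r n : ℕ) :
    HasFreeExponents v u' r n 1 := by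
  by_cases hex : ∃ t, t ≠ 0 ∧ certOp v u' r t = 0
  · obtain ⟨t, ht, ht'⟩ := hex
    refine ⟨(Finset.range n).erase t.natDegree, Finset.erase_subset _ _, ?_, fun s hs hs' => ?_⟩
    · have := Finset.pred_card_le_card_erase (s := Finset.range n) (a := t.natDegree)
      rw [Finset.card_range] at this
      omega
    · by_contra h0
      have hdeg := natDegree_eq_of_certOp_eq_zero hv h0 ht hs' ht'
      have := hs t.natDegree (by simp)
      rw [← hdeg] at this
      exact h0 (leadingCoeff_eq_zero.1 this)
  · push Not at hex
    refine ⟨Finset.range n, subset_rfl, by simp, fun s _ hs' => ?_⟩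
    by_contra h0
    exact hex s h0 hs'

omit [CharZero K] in
theorem hasFreeExponents_zero {v u' : K[X][Y]} {r n : ℕ}
    (h : ∀ s : K[X][Y], s ≠ 0 → s.natDegree < n → certOp v u' r s ≠ 0) :
    HasFreeExponents v u' r n 0 := by
  refine ⟨Finset.range n, subset_rfl, by simp, fun s hs hs' => ?_⟩
  by_contra h0
  refine h s h0 ?_ hs'
  by_contra hlt
  exact h0 (leadingCoeff_eq_zero.1 (hs s.natDegree (by simpa using hlt)))

end FreeExponents

/-- In each summand, p either divides one of the other factors or p² divides c_l, and then p divides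
d(c_l). Repeated factors of ∏ c_ℓ are thus the ones that can be cancelled. -/
theorem dvd_logNum_of_sq_dvd {k R : Type*} [CommRing k] [CommRing R] [IsDomain R] [Algebra k R]
    (d : Derivation k R R) {ι : Type*} [Fintype ι] [DecidableEq ι] (c ε : ι → R) {p : R}
    (hp : Prime p) (h : p ^ 2 ∣ ∏ l, c l) : p ∣ logNum d c ε := by
  refine Finset.dvd_sum fun l _ => ?_
  by_cases hl : p ∣ ∏ j ∈ Finset.univ.erase l, c j
  · exact hl.mul_left _
  · rw [← Finset.mul_prod_erase Finset.univ c (Finset.mem_univ l)] at h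
    obtain ⟨q, hq⟩ := hp.pow_dvd_of_dvd_mul_right 2 hl h
    refine ((Dvd.intro (p * d q + 2 * (q * d p)) ?_).mul_left _).mul_right _
    rw [hq, d.leibniz, d.leibniz_pow]
    simp only [smul_eq_mul, nsmul_eq_mul]
    push_cast
    ring

/-! ### The condition behind φ₃ and cancellation of common factors. -/

namespace TermData

variable {K : Type*} [Field K] (H : TermData K)

/-- The factors whose logarithmic derivatives enter a rational solution of `D_y (s * g) = 0`. -/
def factors (s : K[X][Y]) : Option (Option (Fin H.L)) → K[X][Y]
  | none => s
  | some none => H.den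
  | some (some l) => H.c l

/-- The exponents belonging to `factors`. -/
def exponents (r : ℕ) : Option (Option (Fin H.L)) → K
  | none => 1
  | some none => 1 - r
  | some (some l) => H.e l

theorem factors_ne {s : K[X][Y]} (hs : s ≠ 0) : ∀ l, H.factors s l ≠ 0
  | none => hs
  | some none => H.den_ne
  | some (some l) => H.c_ne l

/-- A kernel element makes s g / v^(r-1) constant in y, so its logarithmic derivative (a/b)' + s'/s
+ (1-r) v'/v + ∑ e_ℓ c_ℓ'/c_ℓ is zero. -/
theorem logNum_factors_of_certOp_eq_zero {r : ℕ} {s : K[X][Y]}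
    (h : certOp H.den (H.num dY) r s = 0) :
    (derivative H.a * H.b - H.a * derivative H.b) * ∏ l, H.factors s l =
      -(H.b ^ 2 * logNum dY (H.factors s) fun l => C (C (H.exponents r l))) := by
  have hb := H.b_mul_expNum dY
  have hprod : ∏ l, H.factors s l = s * (H.den * H.prodC) := by
    simp only [Fintype.prod_option]
    rfl
  have hlog : (logNum dY (H.factors s) fun l => C (C (H.exponents r l))) =
      derivative s * (H.den * H.prodC) + s * ((1 - (r : K[X][Y])) * derivative H.den * H.prodC
        + H.den * H.powNum dY) := by
    rw [logNum_option, logNum_option, Fintype.prod_option]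
    simp only [factors, exponents, map_sub, map_one, map_natCast, one_mul]
    rfl
  rw [certOp_apply, num] at h
  rw [hprod, hlog]
  rw [dY_apply, dY_apply] at hb
  have hden : H.den = H.b * sqfreePart H.b * H.prodC := rfl
  linear_combination H.b ^ 2 * H.prodC * h - H.b * H.prodC ^ 2 * s * hb
    + (s * H.prodC * (derivative H.a * H.b - H.a * derivative H.b)
      + H.b ^ 2 * s * H.powNum dY) * hden

variable [CharZero K]

/-- If no factor can be cancelled, ∏ c_ℓ is square free in y. The poles then give a/b ∈ K(x), the
finite residues give e_ℓ ∈ ℤ, and the degree relation at infinity gives the last condition of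
`RationalInY`. -/
theorem exists_prime_of_certOp_eq_zero {r : ℕ} {s : K[X][Y]} (hs : s ≠ 0)
    (hdeg : (s.natDegree : ℤ) ≤ degY H.c₀ + ((r : ℤ) - 1) * H.gamma + 1)
    (h : certOp H.den (H.num dY) r s = 0) (hR : ¬ H.RationalInY) :
    ∃ p : K[X][Y], p.natDegree ≠ 0 ∧ p ∣ H.prodC ∧ p ∣ H.powNum dX ∧ p ∣ H.powNum dY := by
  have hF := H.factors_ne hs
  obtain ⟨a', q, hq, hab, hlog⟩ :=
    exists_reduced_den H.b_ne hF (H.logNum_factors_of_certOp_eq_zero h)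
  have hqC : (C q : K[X][Y]) ≠ 0 := C_ne_zero.2 hq
  obtain ⟨ha', hsum⟩ := derivative_eq_zero_of_logNum (natDegree_C q) hqC hF hlog
  have ha'C := eq_C_of_natDegree_eq_zero (Polynomial.derivative_eq_zero.1 ha')
  have hab' : H.a * C q = H.b * C (a'.coeff 0) := by rw [← ha'C, hab]
  by_contra hno
  push Not at hno
  have hsq : ∀ p, Prime p → p.natDegree ≠ 0 → ¬ p ^ 2 ∣ H.prodC := fun p hp hp0 hdvd =>
    hno p hp0 ((dvd_pow_self p two_ne_zero).trans hdvd) (dvd_logNum_of_sq_dvd _ _ _ hp hdvd)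
      (dvd_logNum_of_sq_dvd _ _ _ hp hdvd)
  refine hR ⟨⟨_, q, hq, hab'⟩, fun l => ?_, ?_⟩
  · by_contra! hl
    obtain ⟨p, hp, hpl, hp0⟩ := exists_prime_dvd_of_natDegree_ne_zero hl.1
    choose m f hf hmf using fun j => WfDvdMonoid.max_power_factor (hF j) hp.irreducible
    have hpq : ¬ p ∣ C q := fun hdvd => hp0 (Nat.le_zero.1
      ((natDegree_le_of_dvd hdvd hqC).trans (natDegree_C q).le))
    have hres := sum_residue_eq_zero hlog hp hp0 hpq hf hmf
    -- By square freeness p divides c_l once and no other c_j. The vanishing residue is then m(s) +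
    -- (1-r) m(v) + e_l, so e_l is an integer.
    rw [Fintype.sum_option, Fintype.sum_option, Finset.sum_eq_single l] at hres
    · have h1 : m (some (some l)) = 1 := by
        have hc : H.c l = p ^ m (some (some l)) * f (some (some l)) := hmf (some (some l))
        apply le_antisymm
        · by_contra hlt
          apply hsq p hp hp0
          refine dvd_trans ?_ (Finset.dvd_prod_of_mem H.c (Finset.mem_univ l))
          rw [hc]
          exact (pow_dvd_pow p (by omega)).mul_right _
        · rw [Nat.one_le_iff_ne_zero]
          intro h0
          rw [h0, pow_zero, one_mul] at hc
          exact hf _ (hc ▸ hpl)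
      rw [h1] at hres
      simp only [exponents] at hres
      refine hl.2 (-(m none) - (1 - r) * m (some none)) ?_
      push_cast at hres ⊢
      linear_combination hres
    · intro j _ hj
      have hpj : ¬ p ∣ H.c j := by
        intro hpj
        apply hsq p hp hp0
        rw [prodC, ← Finset.mul_prod_erase Finset.univ H.c (Finset.mem_univ l), sq]
        exact mul_dvd_mul hpl (hpj.trans (Finset.dvd_prod_of_mem H.c (by simp [hj])))
      have hc : H.c j = p ^ m (some (some j)) * f (some (some j)) := hmf (some (some j))
      have h0 : m (some (some j)) = 0 := by
        by_contra h0
        exact hpj (hc ▸ (dvd_pow_self p h0).mul_right _)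
      rw [h0, Nat.cast_zero, mul_zero]
    · simp
  · have hda : H.a.natDegree ≤ H.b.natDegree := by
      rcases eq_or_ne H.a 0 with h0 | h0
      · simp [h0]
      · have hne : (C (a'.coeff 0) : K[X][Y]) ≠ 0 :=
          right_ne_zero_of_mul (hab' ▸ mul_ne_zero h0 hqC)
        have := congrArg natDegree hab'
        rw [natDegree_mul h0 hqC, natDegree_mul H.b_ne hne, natDegree_C, natDegree_C] at this
        omega
    -- Since deg_y a ≤ deg_y b, the maximum in γ is deg_y b. The relation at infinity becomes deg_y
    -- s = (r-1)γ - ∑ e_ℓ deg_y c_ℓ, and `hdeg` turns it into the bound -1.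
    have hγ : H.den.natDegree = H.gamma := by
      have : ∑ l, degY (H.c l) = ∑ l, (H.c l).natDegree := rfl
      rw [natDegree_den, gamma, this, degY, degY, degY]
      omega
    rw [Fintype.sum_option, Fintype.sum_option] at hsum
    simp only [factors, exponents, hγ] at hsum
    refine ⟨((r : ℤ) - 1) * H.gamma - s.natDegree, ?_, by linarith⟩
    simp only [degY]
    push_cast
    linear_combination hsum

omit [CharZero K] in
theorem gamma_ne_zero : H.gamma ≠ 0 := by
  have := H.nontrivial_y
  rw [gamma]
  omega

omit [CharZero K] in
theorem phi3_le_one : H.phi3 ≤ 1 := by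
  rw [phi3]
  split_ifs <;> simp

/-- Up to cancellation of a common factor in the logarithmic derivatives, the number of lost
exponents matches `γ + φ₃`. -/
theorem exists_cancelled (r : ℕ) :
    ∃ (g v u u' : K[X][Y]) (Γ φ : ℕ), g ≠ 0 ∧ H.den = g * v ∧ H.num dX = g * u ∧
      H.num dY = g * u' ∧ Γ ≤ H.gamma ∧ Γ + φ = H.gamma + H.phi3 ∧ φ ≤ 1 ∧ v.natDegree ≤ Γ ∧
      u.natDegree ≤ Γ ∧ (X * u').natDegree ≤ Γ ∧
      ∀ n, n + Γ = degY H.c₀ + r * Γ + 2 → HasFreeExponents v u' r n φ := by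
  by_cases hR : H.RationalInY
  · exact ⟨1, H.den, H.num dX, H.num dY, H.gamma, 1, one_ne_zero, (one_mul _).symm,
      (one_mul _).symm, (one_mul _).symm, le_rfl, by rw [phi3, if_pos hR], le_rfl,
      H.natDegree_den_le, H.natDegree_num_dX_le, H.natDegree_X_mul_num_dY_le,
      fun n _ => hasFreeExponents_one _ H.den_ne r n⟩
  have hφ3 : H.phi3 = 0 := by rw [phi3, if_neg hR]
  by_cases hex : ∃ s : K[X][Y], s ≠ 0 ∧ s.natDegree + H.gamma < degY H.c₀ + r * H.gamma + 2 ∧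
      certOp H.den (H.num dY) r s = 0
  · obtain ⟨s, hs, hdeg, hs'⟩ := hex
    obtain ⟨p, hp0, ⟨c, hc⟩, ⟨tx, htx⟩, ⟨ty, hty⟩⟩ := H.exists_prime_of_certOp_eq_zero hs (by
      have : (s.natDegree : ℤ) + H.gamma < degY H.c₀ + r * H.gamma + 2 := by exact_mod_cast hdeg
      linarith) hs' hR
    have hp : p ≠ 0 := by
      rintro rfl
      simp at hp0
    have hγ := H.gamma_ne_zero
    have hle : ∀ {P Q : K[X][Y]}, Q = p * P → Q.natDegree ≤ H.gamma →
        P.natDegree ≤ H.gamma - 1 := by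
      intro P Q hPQ hQ
      rcases eq_or_ne P 0 with rfl | hP
      · simp
      · rw [hPQ, natDegree_mul hp hP] at hQ
        omega
    have hv : H.den = p * (H.b * sqfreePart H.b * c) := by
      rw [den, hc]
      ring
    have hu : H.num dX = p * (H.expNum dX * c + H.b * sqfreePart H.b * tx) := by
      rw [num, hc, htx]
      ring
    have hu' : H.num dY = p * (H.expNum dY * c + H.b * sqfreePart H.b * ty) := by
      rw [num, hc, hty]
      ring
    -- Cancelling p lowers the y-degree bound by one, which balances the one exponent that must be
    -- given up.
    refine ⟨p, _, _, _, H.gamma - 1, 1, hp, hv, hu, hu', Nat.sub_le _ _, by omega, le_rfl,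
      hle hv H.natDegree_den_le, hle hu H.natDegree_num_dX_le,
      hle (Q := X * H.num dY) (by rw [hu']; ring) H.natDegree_X_mul_num_dY_le,
      fun n _ => hasFreeExponents_one _ (right_ne_zero_of_mul (hv ▸ H.den_ne)) r n⟩
  · refine ⟨1, H.den, H.num dX, H.num dY, H.gamma, 0, one_ne_zero, (one_mul _).symm,
      (one_mul _).symm, (one_mul _).symm, le_rfl, by rw [hφ3], zero_le_one,
      H.natDegree_den_le, H.natDegree_num_dX_le, H.natDegree_X_mul_num_dY_le,
      fun n hn => hasFreeExponents_zero fun s hs hlt h0 => hex ⟨s, hs, by omega, h0⟩⟩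

end TermData

/-! ### The term h as a polynomial multiple of g. -/

section Terms

variable {K E : Type*} [Field K] [Field E] [Algebra (RatXY K) E]

theorem derivation_prod_of_logDeriv {ι : Type*} [DecidableEq ι] (δ : Derivation ℤ E E)
    (s : Finset ι) (u ρ : ι → E) (h : ∀ l, δ (u l) = ρ l * u l) :
    δ (∏ l ∈ s, u l) = (∑ l ∈ s, ρ l) * ∏ l ∈ s, u l := by
  induction s using Finset.induction_on with
  | empty => simp
  | insert l s hl ih =>
    rw [Finset.prod_insert hl, Finset.sum_insert hl, δ.leibniz, ih, h]
    simp only [smul_eq_mul]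
    ring

theorem TermData.logDeriv_eq (H : TermData K) {δ : Derivation ℤ E E}
    {d : Derivation K K[X][Y] K[X][Y]} (hδ : ∀ p : K[X][Y], δ (embHom E p) = embHom E (d p))
    {g : E} {u : Fin H.L → E} (hg : δ g = δ (embHom E H.a / embHom E H.b) * g)
    (hu : ∀ l, δ (u l) = embHom E (C (C (H.e l))) *
      (δ (embHom E (H.c l)) / embHom E (H.c l)) * u l) :
    δ (g * ∏ l, u l) = embHom E (H.num d) / embHom E H.den * (g * ∏ l, u l) := by
  have hb := embHom_ne_zero (E := E) H.b_ne
  have hs := embHom_ne_zero (E := E) (sqfreePart_ne_zero H.b)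
  have hc := embHom_ne_zero (E := E) H.prodC_ne
  have h1 : δ (embHom E H.a / embHom E H.b) =
      embHom E (H.expNum d) / (embHom E H.b * embHom E (sqfreePart H.b)) := by
    have := congrArg (embHom E) (H.b_mul_expNum d)
    simp only [map_mul, map_sub] at this
    rw [δ.leibniz_div, hδ, hδ]
    simp only [smul_eq_mul]
    field_simp
    linear_combination -this
  have h2 : ∑ l, embHom E (C (C (H.e l))) * (δ (embHom E (H.c l)) / embHom E (H.c l)) =
      embHom E (H.powNum d) / embHom E H.prodC := by
    rw [eq_div_iff hc, powNum, logNum, map_sum, Finset.sum_mul]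
    refine Finset.sum_congr rfl fun l _ => ?_
    have hcl := embHom_ne_zero (E := E) (H.c_ne l)
    rw [prodC, ← Finset.mul_prod_erase Finset.univ H.c (Finset.mem_univ l), map_mul, map_mul,
      map_mul, hδ]
    field_simp
  rw [δ.leibniz, derivation_prod_of_logDeriv δ _ _ _ hu, hg, h1, h2, num, den]
  simp only [smul_eq_mul, map_add, map_mul]
  field_simp
  ring

theorem TermData.exists_logDeriv (H : TermData K) {D : DiffExt K E} {h : E} (hh : H.IsTerm D h) :
    ∃ g : E, g ≠ 0 ∧ h = embHom E H.c₀ * g ∧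
      D.Dx g = embHom E (H.num dX) / embHom E H.den * g ∧
      D.Dy g = embHom E (H.num dY) / embHom E H.den * g := by
  obtain ⟨g, u, ⟨hg0, hgx, hgy⟩, hu, rfl⟩ := hh
  refine ⟨g * ∏ l, u l, mul_ne_zero hg0 (Finset.prod_ne_zero_iff.2 fun l _ => (hu l).1), ?_,
    H.logDeriv_eq D.Dx_embHom hgx fun l => (hu l).2.1,
    H.logDeriv_eq D.Dy_embHom hgy fun l => (hu l).2.2⟩
  rw [emb_eq, mul_assoc]

end Terms

/-! ### The stated bounds on d imply the counting inequalities. -/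

section Numerics

/-- Here p = φ₁, p' = φ₂, Z = Sy - φ and k = max(0, ψ); the value ψ = -1 is possible. For φ₁ = 1 the
true saving is y + rγ - ψ, of which φ credits only k when φ₂ = 0; `hZk` covers the gap. -/
theorem count_of_bound_degX {d x y r α β γ f ψ k p A Z : ℚ} (hα : 0 ≤ α) (hβ : 0 ≤ β)
    (hψ : ψ = γ + f - 2) (hk : ψ = -1 ∧ k = 0 ∨ 0 ≤ ψ ∧ k = ψ)
    (hZ : Z ≤ y + r * γ - ψ) (hZk : k ≤ y + r * γ - ψ) {p' : ℚ}
    (hp : p = 0 ∧ p' = 0 ∨ p = 1 ∧ (p' = 0 ∨ p' = 1 ∧ β = 0)) (hA : A = α + β + 1 - p)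
    (h : ((α + β) * (2 * γ - 1 + f) + γ - 1) * r + (x + (α + β + 1) * y
      + (γ - 2 + f) * (x - α - β - p')
      - (1 - p') * max 0 (γ - 2 + f) * (p + 1 / 2 * β * (γ - 1 + f))) < d * (r - ψ)) :
    2 * ((d + x + r * α + (r - k) * β + 1) * (ψ + 1) + A * Z) + β * (k * (k + 1)) <
      2 * ((r + 1) * (d + 1)) := by
  have hmax : max 0 (γ - 2 + f) = k := by
    rw [show γ - 2 + f = ψ by rw [hψ]; ring]
    rcases hk with ⟨h1, h2⟩ | ⟨h1, h2⟩
    · rw [h1, h2, max_eq_left (by norm_num)]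
    · rw [h2, max_eq_right h1]
  have hA0 : 0 ≤ A := by rcases hp with ⟨rfl, -⟩ | ⟨rfl, -⟩ <;> rw [hA] <;> linarith
  have hAZ : A * Z ≤ A * (y + r * γ - ψ) := mul_le_mul_of_nonneg_left hZ hA0
  rw [hmax] at h
  obtain rfl : f = ψ - γ + 2 := by rw [hψ]; ring
  subst hA
  rcases hp with ⟨rfl, rfl⟩ | ⟨rfl, rfl | ⟨rfl, rfl⟩⟩ <;>
    rcases hk with ⟨rfl, rfl⟩ | ⟨h1, rfl⟩ <;> linarith

theorem count_of_bound_top {d x y r α γ f ψ Z : ℚ} (hα : 0 ≤ α) (hψ : ψ = γ + f - 2)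
    (hZ : Z ≤ y + r * γ - ψ)
    (h : (α * (2 * γ - 1 + f) - 1) * r + (x + α * y + (γ - 2 + f) * (x + 1 - α)
      - 1 / 2 * max 0 (γ - 2 + f) * (γ + 1 + f)) < d * (r - ψ)) :
    (ψ = -1 → 2 * ((d + x + r * α + 1) * (ψ + 1) + α * Z) < 2 * ((r + 1) * (d + 1))) ∧
    (0 ≤ ψ → 2 * ((d + x + r * α - ψ) * (ψ + 1) + α * Z + 1) + ψ * (ψ + 1) <
      2 * ((r + 1) * (d + 1))) := by
  have hαZ : α * Z ≤ α * (y + r * γ - ψ) := mul_le_mul_of_nonneg_left hZ hα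
  obtain rfl : f = ψ - γ + 2 := by rw [hψ]; ring
  rw [show γ - 2 + (ψ - γ + 2) = ψ by ring] at h
  constructor
  · rintro rfl
    rw [max_eq_left (by norm_num)] at h
    linarith
  · intro h0
    rw [max_eq_right h0] at h
    linarith

theorem count_of_bound_nat {d x y r α γ f ψ n Z : ℚ} (hα : 1 ≤ α) (hψ : ψ = γ + f - 2)
    (hZ : Z ≤ y + r * γ - ψ) (hψ0 : 0 ≤ ψ) (hn0 : 0 ≤ n) (hnψ : n + 1 ≤ ψ) (hx : 0 ≤ x)
    (hy : 0 ≤ y) (hf : f ≤ 1) (hr : ψ + 1 ≤ r)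
    (h : (α * (2 * γ - 1 + f) - 1) * r + (x + α * y + (γ - 2 + f) * (x + 1 - α)
      - 1 / 2 * max 0 (γ - 2 + f) * (γ + 1 + f) - (n + 1) * (γ - 2 + f - n) + 1)
        < d * (r - ψ)) :
    n + 1 ≤ d ∧
    2 * ((d + x + r * α - ψ - (n + 1)) * (ψ + 1) + α * Z + 2) + ψ * (ψ + 1)
      + 2 * ((n + 1) * (n + 1)) < 2 * ((r + 1) * (d + 1)) := by
  have hα0 : 0 ≤ α := by linarith
  have hαZ : α * Z ≤ α * (y + r * γ - ψ) := mul_le_mul_of_nonneg_left hZ hα0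
  obtain rfl : γ = ψ - f + 2 := by rw [hψ]; ring
  rw [show ψ - f + 2 - 2 + f = ψ by ring, max_eq_right hψ0] at h
  constructor
  · have h1 : ψ * (2 * ψ + 1) ≤ α * (ψ * (2 * ψ + 2 - f)) := by
      have : ψ * (2 * ψ + 1) ≤ ψ * (2 * ψ + 2 - f) :=
        mul_le_mul_of_nonneg_left (by linarith) hψ0
      have h0 : 0 ≤ ψ * (2 * ψ + 2 - f) := mul_nonneg hψ0 (by linarith)
      nlinarith
    have h2 : 0 ≤ x * ψ := mul_nonneg hx hψ0
    have h3 : 0 ≤ α * y := mul_nonneg hα0 hy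
    -- Since φ' + ϑψ ≥ 0, the hypothesis gives d > ϑ, and ϑ ≥ 2ψ + 1 ≥ n + 1.
    have h4 : (α * (2 * (ψ - f + 2) - 1 + f) - 1) * (r - ψ) < d * (r - ψ) := by
      nlinarith [sq_nonneg (2 * n + 1 - ψ), sq_nonneg (ψ - 1)]
    have h5 := lt_of_mul_lt_mul_right h4 (by linarith)
    have h6 : 1 * (2 * (ψ - f + 2) - 1 + f) ≤ α * (2 * (ψ - f + 2) - 1 + f) :=
      mul_le_mul_of_nonneg_right hα (by linarith)
    linarith
  · linarith

end Numerics

/-! ### Assembling the reduced data and the main theorem. -/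

section Main

variable {K E : Type*} [Field K] [CharZero K] [Field E] [Algebra (RatXY K) E]

omit [CharZero K] in
theorem degX_right_le_of_eq_mul {P g Q : K[X][Y]} (hg : g ≠ 0) (h : P = g * Q) :
    degX Q ≤ degX P := by
  rcases eq_or_ne Q 0 with rfl | hQ
  · simp [degX]
  · rw [h, degX_mul hg hQ]
    omega

omit [CharZero K] in
theorem top_of_degree_sub_lt {V W : K[X][Y]} {α : ℕ} {w : K} (hV : V.natDegree ≤ α)
    (h : (W - C (C w) * V).degree < (α : WithBot ℕ)) :
    W.natDegree ≤ α ∧ W.coeff α = C w * V.coeff α := by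
  rw [degree_lt_iff_coeff_zero] at h
  constructor
  · rw [natDegree_le_iff_coeff_eq_zero] at hV ⊢
    intro n hn
    have := h n hn.le
    rwa [coeff_sub, coeff_C_mul, hV n hn, mul_zero, sub_zero] at this
  · have := h α le_rfl
    rwa [coeff_sub, coeff_C_mul, sub_eq_zero] at this

/-- The logarithmic derivatives of the exponential part of `h`, in the form used for counting. -/
theorem TermData.exists_reduced (H : TermData K) {D : DiffExt K E} {h : E} (hh : H.IsTerm D h)
    {r : ℕ} (hr : H.psi + 1 ≤ (r : ℤ)) :
    ∃ (g : E) (v u u' : K[X][Y]) (Γ Sy φ : ℕ), g ≠ 0 ∧ h = embHom E H.c₀ * g ∧ v ≠ 0 ∧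
      D.Dx g = embHom E u / embHom E v * g ∧ D.Dy g = embHom E u' / embHom E v * g ∧
      (Γ : ℤ) + φ - 1 = H.psi + 1 ∧
      (Sy : ℤ) - φ ≤ degY H.c₀ + r * H.gamma - H.psi ∧
      degX v ≤ H.alpha ∧ degX u ≤ degX (H.num dX) ∧ degX u' ≤ degX (H.num dY) ∧
      (degX H.a ≤ degX H.b →
        (X * Bivariate.swap u).natDegree ≤ H.alpha ∧ (X * Bivariate.swap u).coeff H.alpha =
          C H.omegaPow * (Bivariate.swap v).coeff H.alpha) ∧
      v.natDegree ≤ Γ ∧ u.natDegree ≤ Γ ∧ (X * u').natDegree ≤ Γ ∧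
      Sy + Γ = H.c₀.natDegree + r * Γ + 2 ∧ φ ≤ Sy ∧ HasFreeExponents v u' r Sy φ := by
  obtain ⟨g, hg, hhg, hx, hy⟩ := H.exists_logDeriv hh
  obtain ⟨t, v, u, u', Γ, φ, ht, hv, hu, hu', hΓ, hΓφ, hφ, hvy, huy, huy', hfree⟩ :=
    H.exists_cancelled r
  have hv0 : v ≠ 0 := right_ne_zero_of_mul (hv ▸ H.den_ne)
  have ht' := embHom_ne_zero (E := E) ht
  have hv' := embHom_ne_zero (E := E) hv0
  have hpsi : (Γ : ℤ) + φ - 1 = H.psi + 1 := by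
    rw [psi]
    have : (Γ : ℤ) + φ = H.gamma + H.phi3 := by exact_mod_cast hΓφ
    linarith
  have hSy : Γ + 1 ≤ H.c₀.natDegree + r * Γ + 2 := by
    rcases Nat.eq_zero_or_pos r with rfl | h0
    · omega
    · have := Nat.le_mul_of_pos_left Γ h0
      omega
  have hαv : degX v ≤ H.alpha := (degX_right_le_of_eq_mul ht hv).trans H.degX_den.le
  have hrΓ : (r : ℤ) * Γ ≤ r * H.gamma :=
    mul_le_mul_of_nonneg_left (by exact_mod_cast hΓ) (by positivity)
  have hSy' : H.c₀.natDegree + r * Γ + 2 - Γ + Γ = H.c₀.natDegree + r * Γ + 2 := by omega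
  refine ⟨g, v, u, u', Γ, H.c₀.natDegree + r * Γ + 2 - Γ, φ, hg, hhg, hv0, ?_, ?_, hpsi, ?_, hαv,
    degX_right_le_of_eq_mul ht hu, degX_right_le_of_eq_mul ht hu', fun hab => ?_, hvy, huy, huy',
    hSy', by omega, hfree _ hSy'⟩
  · rw [hx, hu, hv, map_mul, map_mul, mul_div_mul_left _ _ ht']
  · rw [hy, hu', hv, map_mul, map_mul, mul_div_mul_left _ _ ht']
  · rw [Nat.cast_sub (by omega)]
    push_cast
    simp only [degY]
    linarith
  -- The strict bound for the uncancelled data survives division by t; α is kept as the reference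
  -- degree even if v has smaller x-degree.
  · refine top_of_degree_sub_lt hαv ((degree_le_mul_left _ (swap_ne_zero ht)).trans_lt ?_)
    refine lt_of_eq_of_lt (congrArg degree ?_) (H.degree_X_mul_num_sub_lt hab)
    rw [hu, hv, map_mul, map_mul]
    ring

end Main

end CreativeTelescoping

end

open CreativeTelescoping in
theorem theorem1 {K E : Type*} [Field K] [CharZero K] [Field E] [Algebra (RatXY K) E]
    (D : DiffExt K E) (H : TermData K) (h : E) (hh : H.IsTerm D h)
    (r d : ℕ) (hr : H.psi + 1 ≤ (r : ℤ)) :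
    (degX H.b < degX H.a →
      (H.theta1 * r + H.varphi1) / ((r : ℚ) - H.psi) < d → HasRelation D h r d) ∧
    (degX H.a ≤ degX H.b →
      ((H.theta2 * r + H.varphi2) / ((r : ℚ) - H.psi) < d → HasRelation D h r d) ∧
      (∀ (n : ℕ) (δ : ℤ), H.omega = (n : K) → (n : ℤ) < (H.gamma : ℤ) - 1 + H.phi3 →
        δ = (n : ℤ) + 1 →
        (H.theta2 * r + H.varphi2' δ n) / ((r : ℚ) - H.psi) < d → HasRelation D h r d)) := by
  obtain ⟨g, v, u, u', Γ, Sy, φ, hg, rfl, hv, hx, hy, hpsi, hZ, hvx, hux, hux', htop, hvy, huy,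
    huy', hSy, hφ, hfree⟩ := H.exists_reduced hh hr
  have hψ : H.psi = (H.gamma : ℤ) + H.phi3 - 2 := rfl
  have hγ : 1 ≤ H.gamma := Nat.one_le_iff_ne_zero.2 H.gamma_ne_zero
  have hf := H.phi3_le_one
  have hψQ : (H.psi : ℚ) = (H.gamma : ℚ) + H.phi3 - 2 := by rw [hψ]; push_cast; ring
  have hpos : (0 : ℚ) < (r : ℚ) - H.psi := by
    have : ((H.psi + 1 : ℤ) : ℚ) ≤ r := by exact_mod_cast hr
    push_cast at this
    linarith
  have hZQ : (Sy : ℚ) - φ ≤ degY H.c₀ + r * H.gamma - H.psi := by exact_mod_cast hZ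
  have hcases : H.psi = -1 ∨ ∃ k : ℕ, H.psi = k := by
    rcases lt_or_ge H.psi 0 with h0 | h0
    · left
      omega
    · exact Or.inr (Int.eq_ofNat_of_zero_le h0)
  refine ⟨fun hlt hd => ?_, fun hle => ?_⟩
  · obtain ⟨β, hβ⟩ := Nat.exists_eq_add_of_lt hlt
    have hβ' : H.beta = β := by
      rw [TermData.beta, hβ]
      push_cast
      ring
    rw [div_lt_iff₀ hpos, TermData.theta1, TermData.varphi1, hβ', Int.cast_natCast] at hd
    obtain ⟨k, hk⟩ : ∃ k : ℕ, H.psi = -1 ∧ k = 0 ∨ 0 ≤ H.psi ∧ (k : ℤ) = H.psi := by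
      rcases hcases with h0 | ⟨k, h0⟩
      · exact ⟨0, Or.inl ⟨h0, rfl⟩⟩
      · exact ⟨k, Or.inr ⟨by omega, h0.symm⟩⟩
    have hkr : k ≤ r := by omega
    have hZk : (k : ℤ) ≤ degY H.c₀ + r * H.gamma - H.psi := by
      rcases hk with ⟨h1, rfl⟩ | ⟨h1, h2⟩
      · have : (0 : ℤ) ≤ r * H.gamma := by positivity
        omega
      · have h3 : (H.psi + 1) * (H.psi + 1) ≤ (r : ℤ) * H.gamma :=
          mul_le_mul hr (by omega) (by omega) (by positivity)
        nlinarith [sq_nonneg H.psi]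
    obtain ⟨p, hp, hpA⟩ : ∃ p : ℕ, (p = H.phi1 ∧ p ≤ 1) ∧
        degX u' ≤ H.alpha + β + 1 - p := by
      by_cases hlc : H.LcQuotConst
      · exact ⟨1, ⟨by rw [TermData.phi1, if_pos hlc], le_rfl⟩,
          hux'.trans (H.degX_num_dY_le_of_lcQuotConst hβ hlc)⟩
      · exact ⟨0, ⟨by rw [TermData.phi1, if_neg hlc], zero_le_one⟩,
          hux'.trans (H.degX_num_dY_le_of_lt hβ)⟩
    have hpp : ((p : ℚ) = 0 ∧ (H.phi2 : ℚ) = 0) ∨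
        ((p : ℚ) = 1 ∧ ((H.phi2 : ℚ) = 0 ∨ (H.phi2 : ℚ) = 1 ∧ (β : ℚ) = 0)) := by
      rw [hp.1, TermData.phi1, TermData.phi2, hβ']
      by_cases hlc : H.LcQuotConst <;> by_cases h0 : β = 0 <;> simp [hlc, h0]
    refine hasRelation_of_degX_le hg hv hx hy H.c₀ (A := H.alpha + β + 1 - p) hvx (by omega)
      (hux.trans (H.degX_num_dX_le hβ)) hpA hvy huy huy' hSy hφ hfree k hkr ?_
    rw [hpsi]
    have hA : ((H.alpha + β + 1 - p : ℕ) : ℚ) = H.alpha + β + 1 - p := by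
      rw [Nat.cast_sub (by omega)]
      push_cast
      ring
    have hkQ : (H.psi : ℚ) = -1 ∧ (k : ℚ) = 0 ∨ (0 : ℚ) ≤ H.psi ∧ (k : ℚ) = H.psi := by
      rcases hk with ⟨h1, h2⟩ | ⟨h1, h2⟩
      · exact Or.inl ⟨by exact_mod_cast h1, by exact_mod_cast h2⟩
      · exact Or.inr ⟨by exact_mod_cast h1, by exact_mod_cast h2⟩
    rw [← hp.1] at hd
    have := count_of_bound_degX (Nat.cast_nonneg _) (Nat.cast_nonneg _) hψQ hkQ hZQ
      (by exact_mod_cast hZk) hpp hA hd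
    exact_mod_cast this
  · have hα : H.alpha ≠ 0 := by
      have := H.nontrivial_x
      rw [TermData.alpha]
      omega
    obtain ⟨hXu, hXu'⟩ := htop hle
    have hu'α := hux'.trans (H.degX_num_dY_le_of_le hle)
    obtain ⟨α, hα'⟩ := Nat.exists_eq_succ_of_ne_zero hα
    have hαQ : (H.alpha : ℚ) = α + 1 := by rw [hα']; push_cast; ring
    rw [Nat.succ_eq_add_one] at hα'
    have main : (H.theta2 * r + H.varphi2) / ((r : ℚ) - H.psi) < d →
        HasRelation D (embHom E H.c₀ * g) r d := by
      intro hd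
      rw [div_lt_iff₀ hpos, TermData.theta2, TermData.varphi2] at hd
      obtain ⟨c1, c2⟩ := count_of_bound_top (Nat.cast_nonneg _) hψQ hZQ hd
      rcases hcases with h0 | ⟨k, h0⟩
      -- For ψ = -1 the factor Γ + φ - 1 is zero, so lowering Ex brings nothing, and the plain count
      -- with no shortening and no functional is used.
      · refine hasRelation_of_degX_le hg hv hx hy H.c₀ (β := 0) hvx le_rfl ?_ hu'α hvy huy huy'
          hSy hφ hfree 0 (Nat.zero_le r) ?_
        · exact natDegree_le_of_natDegree_X_mul_le (hXu.trans (Nat.le_succ _))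
        · rw [hpsi]
          have := c1 (by exact_mod_cast h0)
          simp only [Nat.cast_zero, mul_zero, zero_mul, add_zero]
          exact_mod_cast this
      · rw [hα'] at hvx hXu hXu' hu'α
        refine hasRelation_of_top hg hv hx hy H.c₀ hvx hXu hXu' hu'α hvy huy huy' hSy hφ hfree k
          (by omega) ?_
        rw [hpsi]
        have := c2 (by rw [h0]; positivity)
        rw [hαQ, h0] at this
        rw [h0]
        exact_mod_cast this
    refine ⟨main, fun n δ hn hnψ hδ hd => ?_⟩
    have hnψ' : (n : ℤ) ≤ H.psi := by omega
    have hδQ : (δ : ℚ) = n + 1 := by rw [hδ]; push_cast; ring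
    -- For n = ψ the replacement is φ' = φ + 1, weaker than the bound already proved; only n < ψ
    -- requires the refined count.
    rcases hnψ'.eq_or_lt with heq | hlt
    · apply main
      have hnQ : (H.gamma : ℚ) - 2 + H.phi3 - n = 0 := by
        have : (n : ℚ) = H.psi := by exact_mod_cast heq
        rw [this, hψQ]
        ring
      rw [TermData.varphi2', hnQ, mul_zero, sub_zero] at hd
      refine lt_of_le_of_lt ?_ hd
      gcongr
      linarith
    · obtain ⟨k, h0⟩ : ∃ k : ℕ, H.psi = k := Int.eq_ofNat_of_zero_le (by omega)
      rw [div_lt_iff₀ hpos, TermData.theta2, TermData.varphi2', TermData.varphi2, hδQ] at hd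
      have hrQ : (H.psi : ℚ) + 1 ≤ r := by exact_mod_cast hr
      obtain ⟨c1, c2⟩ := count_of_bound_nat (by rw [hαQ]; linarith [(Nat.cast_nonneg α : (0 : ℚ) ≤ α)])
        hψQ hZQ (by rw [h0]; positivity) (Nat.cast_nonneg n) (by exact_mod_cast hlt)
        (Nat.cast_nonneg _) (Nat.cast_nonneg _) (by exact_mod_cast hf) hrQ hd
      rw [hα'] at hvx hXu hXu' hu'α
      refine hasRelation_of_nat hg hv hx hy H.c₀ hvx hXu hXu' (H.omega_eq ▸ hn) hu'α hvy huy huy'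
        hSy hφ hfree k (by omega) (by omega) (by exact_mod_cast c1) ?_
      rw [hpsi]
      rw [hαQ, h0] at c2
      rw [h0]
      exact_mod_cast c2
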